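/- Let $\mathbb F_q$ be the finite field with $q>2$ elements, $R=M_2(\mathbb F_q)$ and $G=\mathrm{GL}_2(\mathbb F_q)$. For $X\in R$ let $C_X=\{uXu^{-1}:u\in G\}$ be its similarity class. Let $Q$ be a probability distribution on $R$ that is constant on similarity classes, and let $B_R$ be the $R\times R$ matrix with entries $B_R(a,b)=\sum_{x\in R,\;xa=b}Q(x)$. Let $\psi$ be a set of representatives of the similarity classes of $R$ and $\psi^\times=\psi\cap G$. Put $Y_0=\begin{pmatrix}0&0\\1&0\end{pmatrix}$ and $Y_t=\begin{pmatrix}t&0\\0&0\end{pmatrix}$ for $t\in\mathbb F_q^\times$. For a finite-dimensional complex representation $\rho$ of $G$ write $\chi_\rho$ for its character. For characters $\mu_1,\mu_2$ of $\mathbb F_q^\times$ let $\rho_{\mu_1,\mu_2}$ be the representation of $G$ induced from the character $\begin{pmatrix}u&w\\0&v\end{pmatrix}\mapsto\mu_1(u)\mu_2(v)$ of the upper triangular subgroup; let $\mathbf 1$ be the trivial representation of $G$, $1_q$ the trivial character of $\mathbb F_q^\times$, and $\rho_{1_q}$ a $G$-stable complement of $\mathbf 1$ in $\rho_{1_q,1_q}$.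 For $A\in R$ let $\Sigma_A$ be the set of (classes of) irreducible complex representations $\rho$ of $G$ with $\mathrm{Hom}_G(\rho,\mathrm{Ind}_{\mathrm{LStab}(A)}^G\mathbf 1)\neq 0$, where $\mathrm{LStab}(A)=\{u\in G: uA=A\}$. The spectrum of $B_R$ over $\mathbb C$, counted with algebraic multiplicity (that is, the multiset of roots of its characteristic polynomial), is the union with multiplicities of the following three families; values that coincide have their multiplicities added. (a) (Unit ideal.) For every irreducible complex representation $\rho$ of $G$, up to isomorphism, $$\lambda_\rho=\frac1{\dim\rho}\sum_{X\in\psi^\times}Q(X)\,|C_X|\,\chi_\rho(X),$$ with multiplicity $(\dim\rho)^2$. There are finitely many such $\rho$, and $\sum_\rho(\dim\rho)^2=|G|$. (b) (Ideals generated by a matrix of rank one.) For every $A$ of rank one, $\Sigma_A$ consists of the classes of $\mathbf 1$, $\rho_{1_q}$ and $\rho_{\chi,1_q}$ with $\chi\neq 1_q$ a character of $\mathbb F_q^\times$; these are irreducible, of dimensions $1$, $q$ and $q+1$, and the $\rho_{\chi,1_q}$ are pairwise inequivalent. Each of these representations $\rho$ gives the eigenvalue $$\lambda_\rho=\frac1{\dim\rho}\Bigl[\sum_{X\in\psi^\times}Q(X)|C_X|\chi_\rho(X)+Q(Y_0)\Bigl((q^2-1)\chi_\rho\begin{pmatrix}1&1\\0&1\end{pmatrix}-(q-1)\chi_\rho\begin{pmatrix}1&0\\0&1\end{pmatrix}\Bigr)+\sum_{t\in\mathbb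 F_q^\times}Q(Y_t)\Bigl((q^2-1)\chi_\rho\begin{pmatrix}t&1\\0&t\end{pmatrix}+\chi_\rho\begin{pmatrix}t&0\\0&t\end{pmatrix}\Bigr)\Bigr],$$ with multiplicity $(q+1)\dim\rho$. (c) (Zero ideal.) $\sum_{X\in\psi}Q(X)|C_X|=1$, with multiplicity one. Altogether these are $|G|+(q+1)\bigl(1+q+(q-2)(q+1)\bigr)+1=q^4=|R|$ eigenvalues. -/

import Mathlib

open Polynomial Matrix

noncomputable section

namespace RingWalk

/-! ### Multiplicative walks on a finite ring -/

/-- The similarity class `C_r = {u r u⁻¹ : u ∈ Rˣ}` of `r`. -/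
def simClass {R : Type*} [Ring R] (r : R) : Set R :=
  {s | ∃ u : Rˣ, s = (u : R) * r * ((u⁻¹ : Rˣ) : R)}

/-- `Q` is a probability distribution on `R`. -/
def IsDistribution {R : Type*} [Fintype R] (Q : R → ℝ) : Prop :=
  (∀ x, 0 ≤ Q x) ∧ ∑ x, Q x = 1

/-- `Q` is constant on similarity classes. -/
def IsSimilarityInvariant {R : Type*} [Ring R] (Q : R → ℝ) : Prop :=
  ∀ r, ∀ s ∈ simClass r, Q s = Q r

/-- `ψ` contains exactly one element of each similarity class of `R`. -/
def IsSimilarityTransversal {R : Type*} [Ring R] (ψ : Finset R) : Prop :=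
  ∀ r : R, ∃! s, s ∈ ψ ∧ s ∈ simClass r

/-- The matrix `B_R(a, b) = ∑_{x : x a = b} Q(x)` of multiplicative transitions. -/
def mulTransition {R : Type*} [Ring R] [Fintype R] [DecidableEq R] (Q : R → ℝ) : Matrix R R ℝ :=
  Matrix.of fun a b => ∑ x : R with x * a = b, Q x

/-! ### Isomorphism classes of irreducible complex representations -/

/-- Irreducible complex representations of `G` on the spaces `ℂⁿ`. -/
def IrrRep (G : Type*) [Group G] : Type _ :=
  {p : Σ n : ℕ, Representation ℂ G (Fin n → ℂ) // p.2.IsIrreducible}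

/-- Isomorphism of representations. -/
instance irrSetoid (G : Type*) [Group G] : Setoid (IrrRep G) where
  r p p' := Nonempty (p.1.2.Equiv p'.1.2)
  iseqv :=
    { refl := fun _ => ⟨Representation.Equiv.refl _⟩
      symm := fun ⟨e⟩ => ⟨e.symm⟩
      trans := fun ⟨e⟩ ⟨e'⟩ => ⟨e.trans e'⟩ }

/-- `Irr(G)`: the set of isomorphism classes of finite-dimensional irreducible complex
representations of `G`. -/
def Irr (G : Type*) [Group G] : Type _ := Quotient (irrSetoid G)

/-- The dimension of (a member of) an isomorphism class. -/
def Irr.dim {G : Type*} [Group G] (c : Irr G) : ℕ := (Quotient.out c).1.1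

/-- A representation belonging to the isomorphism class `c`. -/
def Irr.rep {G : Type*} [Group G] (c : Irr G) : Representation ℂ G (Fin c.dim → ℂ) :=
  (Quotient.out c).1.2

/-- `Ind_{LStab(a)}^{Rˣ}(1)`, where `LStab(a) = {u ∈ Rˣ : u a = a}`. -/
def indLStab {R : Type*} [Ring R] (a : R) :=
  Representation.ind (MulAction.stabilizer Rˣ a).subtype
    (Representation.trivial ℂ (MulAction.stabilizer Rˣ a) ℂ)

/-- `Σ_a`: the classes `ρ` with `Hom_{Rˣ}(ρ, Ind_{LStab(a)}^{Rˣ}(1)) ≠ 0`. -/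
def constituents {R : Type*} [Ring R] (a : R) : Set (Irr Rˣ) :=
  {c | ∃ f : c.rep.IntertwiningMap (indLStab a), f ≠ 0}

/-! ### The representations of `GL₂(F)` that occur for the rank-one ideals

Characters of `Fˣ` are Mathlib's multiplicative characters `MulChar F ℂ` (extended by `0` at
`0 ∈ F`). -/

section GLTwo

variable (F : Type*) [Field F]

/-- The subgroup of upper triangular matrices. -/
def borel : Subgroup (GL (Fin 2) F) where
  carrier := {g | g 1 0 = 0}
  one_mem' := by simp
  mul_mem' := by
    intro a b ha hb
    simp only [Set.mem_ofPred_eq] at ha hb ⊢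
    simp [Matrix.mul_apply, Fin.sum_univ_two, ha, hb]
  inv_mem' := by
    intro a ha
    simp only [Set.mem_ofPred_eq] at ha ⊢
    simp [Matrix.coe_units_inv, Matrix.inv_def, Matrix.adjugate_fin_two, ha]

variable {F}

/-- The one-dimensional representation `(u w; 0 v) ↦ μ₁(u) μ₂(v)` of the upper triangular group. -/
def borelChar (μ₁ μ₂ : MulChar F ℂ) : Representation ℂ (borel F) ℂ where
  toFun g := (μ₁ ((g : GL (Fin 2) F) 0 0) * μ₂ ((g : GL (Fin 2) F) 1 1)) • LinearMap.id
  map_one' := by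
    ext
    simp
  map_mul' := by
    intro g h
    have hg : (g : GL (Fin 2) F) 1 0 = 0 := g.2
    have hh : (h : GL (Fin 2) F) 1 0 = 0 := h.2
    ext
    simp [Matrix.mul_apply, Fin.sum_univ_two, hg, hh]
    ring

/-- `ρ_{μ₁,μ₂}`, induced from the upper triangular group. -/
def rhoPair (μ₁ μ₂ : MulChar F ℂ) :=
  Representation.ind (borel F).subtype (borelChar μ₁ μ₂)

/-- The subrepresentation of `ρ_{μ,μ}` of all vectors on which `GL₂(F)` acts through `μ ∘ det`:
the constituent `det_μ` of `ρ_{μ,μ}`. -/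
def detConstituent (μ : MulChar F ℂ) : Subrepresentation (rhoPair μ μ) where
  toSubmodule :=
    { carrier := {v | ∀ g : GL (Fin 2) F,
        rhoPair μ μ g v = μ ((g : Matrix (Fin 2) (Fin 2) F).det) • v}
      add_mem' := by
        intro a b ha hb g
        rw [map_add, ha g, hb g, smul_add]
      zero_mem' := by
        intro g
        simp
      smul_mem' := by
        intro c v hv g
        rw [map_smul, hv g, smul_comm] }
  apply_mem_toSubmodule := by
    intro h v hv g
    rw [hv h, map_smul, hv g, smul_comm]

variable [Fintype F]

theorem exists_isCompl_detConstituent (μ : MulChar F ℂ) :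
    ∃ W : Subrepresentation (rhoPair μ μ), IsCompl (detConstituent μ) W :=
  exists_isCompl (detConstituent μ)

/-- A `GL₂(F)`-stable complement of `det_μ` in `ρ_{μ,μ}`. -/
def detComplement (μ : MulChar F ℂ) : Subrepresentation (rhoPair μ μ) :=
  Classical.choose (exists_isCompl_detConstituent μ)

/-- `ρ_μ`, the representation of `GL₂(F)` on the complement of `det_μ` in `ρ_{μ,μ}`. -/
def rhoCompl (μ : MulChar F ℂ) := (detComplement μ).toRepresentation

variable [DecidableEq F]

/-! ### The three kinds of eigenvalues for `M₂(F)` -/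

/-- The matrix `(t 1; 0 t)`. -/
def jordan (t : Fˣ) : GL (Fin 2) F :=
  Matrix.GeneralLinearGroup.mkOfDetNeZero !![(t : F), 1; 0, (t : F)] (by simp)

/-- The matrix `(t 0; 0 t)`. -/
def scalarGL (t : Fˣ) : GL (Fin 2) F := Matrix.GeneralLinearGroup.scalar (Fin 2) t

/-- `Y₀ = (0 0; 1 0)`. -/
def Y₀ : Matrix (Fin 2) (Fin 2) F := !![0, 0; 1, 0]

/-- `Y_t = (t 0; 0 0)`. -/
def Y (t : Fˣ) : Matrix (Fin 2) (Fin 2) F := !![(t : F), 0; 0, 0]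

variable {V : Type*} [AddCommGroup V] [Module ℂ V]

/-- `∑_{X ∈ ψ^×} Q(X) |C_X| χ_ρ(X)`, where `ψ^×` is the set of invertible elements of `ψ`. -/
def unitSum (Q : Matrix (Fin 2) (Fin 2) F → ℝ) (ψ : Finset (Matrix (Fin 2) (Fin 2) F))
    (ρ : Representation ℂ (GL (Fin 2) F) V) : ℂ :=
  ∑ X ∈ (Finset.univ : Finset (GL (Fin 2) F)).filter (fun X => X.val ∈ ψ),
    (Q X.val : ℂ) * ((simClass X.val).ncard : ℂ) * ρ.character X

/-- The eigenvalue attached to `ρ` by the unit ideal. -/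
def unitEigenvalue (Q : Matrix (Fin 2) (Fin 2) F → ℝ) (ψ : Finset (Matrix (Fin 2) (Fin 2) F))
    (ρ : Representation ℂ (GL (Fin 2) F) V) : ℂ :=
  unitSum Q ψ ρ / (Module.finrank ℂ V : ℂ)

/-- The eigenvalue attached to `ρ` by each of the ideals generated by a matrix of rank one. -/
def rankOneEigenvalue (Q : Matrix (Fin 2) (Fin 2) F → ℝ)
    (ψ : Finset (Matrix (Fin 2) (Fin 2) F)) (ρ : Representation ℂ (GL (Fin 2) F) V) : ℂ :=
  (unitSum Q ψ ρ
    + (Q Y₀ : ℂ) * (((Fintype.card F : ℂ) ^ 2 - 1) * ρ.character (jordan 1)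
        - ((Fintype.card F : ℂ) - 1) * ρ.character 1)
    + ∑ t : Fˣ, (Q (Y t) : ℂ) * (((Fintype.card F : ℂ) ^ 2 - 1) * ρ.character (jordan t)
        + ρ.character (scalarGL t))) / (Module.finrank ℂ V : ℂ)

/-- The eigenvalue attached to the zero ideal. -/
def zeroEigenvalue (Q : Matrix (Fin 2) (Fin 2) F → ℝ)
    (ψ : Finset (Matrix (Fin 2) (Fin 2) F)) : ℂ :=
  ∑ X ∈ ψ, (Q X : ℂ) * ((simClass X).ncard : ℂ)

/-- The trivial representation of `GL₂(F)`. -/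
def trivGL (F : Type*) [Field F] : Representation ℂ (GL (Fin 2) F) ℂ :=
  Representation.trivial ℂ (GL (Fin 2) F) ℂ

end GLTwo

end RingWalk

end

open RingWalk

/-! ### Characteristic polynomials of scalars and of block-diagonal operators -/

namespace LinearMap

/-! Left multiplication never lowers the corank, so ordering matrices by corank makes `B_R` block
triangular (`blockTriangular_mulTransition`), with one diagonal block each for the invertible
matrices, the matrices of rank one and the zero matrix. The last block is the number `∑ Q = 1`.

On the invertible block `B_R` is, up to transposition, `∑ Q(g) g` in the regular representation.
Since `Q` is a class function, Schur's lemma makes this sum a scalar on every irreducible, and the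
trace identifies the scalar (`sum_smul_eq_smul_id_of_isIrreducible`). An irreducible `ρ` occurs `dim
ρ` times, so its eigenvalue has multiplicity `(dim ρ)²` (`charpoly_sum_regular`).

A matrix of rank one is `v wᵀ`, and `x (v wᵀ) = (x v) wᵀ`. The row `w`, normalised to echelon form,
takes `q + 1` values and never changes, so the middle block is `q + 1` copies of one walk on the
nonzero vectors `v` (`charpoly_block_one`). Singular `x` take part in this walk although they are
not in `GL₂`. The decisive point is that their contribution equals that of a class function on `GL₂`
(`sum_mulVec_base_singular`): among matrices with first column `(a, c)` and given trace and
determinant there is exactly one if `c ≠ 0`; if `c = 0` there are `q` or none, according to whether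
`a` is a root of the characteristic polynomial. So the class of `Y_t` acts like the set of all
matrices with characteristic polynomial `(X - t)²`, and the class of `Y₀` like the set for `(X -
1)²` minus `q` times the identity. Each such set has `q²` elements, one scalar and `q² - 1`
conjugates of a Jordan block, which yields the coefficients in (b).

The walk on nonzero vectors is thus a class function acting on the permutation representation, which
is the direct sum of all `ρ_{χ,1}` (`planeEquiv`). An endomorphism of it is a combination of scalar
translations and the sum functional (`exists_permRep_endomorphism_eq`), because `GL₂` is transitive
on independent pairs. Translations are scalars on each `ρ_{χ,1}` and the sum functional vanishes
there unless `χ = 1`. This gives irreducibility and inequivalence, and splits `ρ_{1,1}` into the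
trivial representation and an irreducible complement. -/

theorem charpoly_smul_id {K V : Type*} [Field K] [AddCommGroup V] [Module K V]
    [FiniteDimensional K V] (c : K) :
    (c • (LinearMap.id : V →ₗ[K] V)).charpoly = (X - C c) ^ Module.finrank K V := by
  classical
  rw [← LinearMap.charpoly_toMatrix _ (Module.finBasis K V)]
  have : LinearMap.toMatrix (Module.finBasis K V) (Module.finBasis K V)
      (c • (LinearMap.id : V →ₗ[K] V)) = Matrix.diagonal fun _ => c := by
    rw [map_smul, LinearMap.toMatrix_id, Matrix.smul_one_eq_diagonal]
  rw [this, Matrix.charpoly_diagonal]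
  simp

end LinearMap

theorem Matrix.charpoly_blockDiagonal' {K ι : Type*} [CommRing K] [Fintype ι] [DecidableEq ι]
    {m : ι → Type*} [∀ i, Fintype (m i)] [∀ i, DecidableEq (m i)]
    (M : ∀ i, Matrix (m i) (m i) K) :
    (Matrix.blockDiagonal' M).charpoly = ∏ i, (M i).charpoly := by
  have h : Matrix.charmatrix (Matrix.blockDiagonal' M) =
      Matrix.blockDiagonal' fun i => Matrix.charmatrix (M i) := by
    ext ⟨i, a⟩ ⟨j, b⟩
    by_cases hij : i = j
    · subst hij
      by_cases hab : a = b
      · subst hab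
        simp
      · have : (⟨i, a⟩ : Σ i, m i) ≠ ⟨i, b⟩ := by simpa using hab
        simp [hab, this]
    · have : (⟨i, a⟩ : Σ i, m i) ≠ ⟨j, b⟩ := fun h => hij (congrArg Sigma.fst h)
      simp [Matrix.blockDiagonal'_apply, hij, this]
  -- The order is arbitrary; it only serves to read a block-diagonal matrix as block triangular.
  let _ : LinearOrder ι := LinearOrder.lift' (Fintype.equivFin ι) (Fintype.equivFin ι).injective
  rw [Matrix.charpoly, h, (Matrix.blockTriangular_blockDiagonal' _).det_fintype]
  refine Finset.prod_congr rfl fun i _ => ?_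
  let e : m i ≃ {a : Σ i, m i // a.1 = i} :=
    { toFun := fun a => ⟨⟨i, a⟩, rfl⟩
      invFun := fun a => a.2 ▸ a.1.2
      left_inv := fun a => rfl
      right_inv := by rintro ⟨⟨j, a⟩, rfl⟩; rfl }
  rw [Matrix.charpoly, ← Matrix.det_submatrix_equiv_self e]
  congr 1
  ext a b
  simp [e, Matrix.toSquareBlock, Matrix.toSquareBlockProp]

theorem LinearMap.charpoly_eq_prod_of_equiv_pi {K W ι : Type*} [Field K] [AddCommGroup W]
    [Module K W] [FiniteDimensional K W] [Fintype ι] {V : ι → Type*} [∀ i, AddCommGroup (V i)]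
    [∀ i, Module K (V i)] [∀ i, FiniteDimensional K (V i)] (e : W ≃ₗ[K] ∀ i, V i)
    (T : W →ₗ[K] W) (S : ∀ i, V i →ₗ[K] V i) (h : ∀ w i, e (T w) i = S i (e w i)) :
    T.charpoly = ∏ i, (S i).charpoly := by
  classical
  let b := Pi.basis fun i => Module.finBasis K (V i)
  rw [← LinearMap.charpoly_toMatrix T (b.map e.symm)]
  have : LinearMap.toMatrix (b.map e.symm) (b.map e.symm) T = Matrix.blockDiagonal' fun i =>
      LinearMap.toMatrix (Module.finBasis K (V i)) (Module.finBasis K (V i)) (S i) := by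
    ext ⟨i, a⟩ ⟨j, c⟩
    simp only [LinearMap.toMatrix_apply, Module.Basis.map_apply, Module.Basis.map_repr,
      LinearEquiv.trans_apply, LinearEquiv.symm_symm, b, Pi.basis_apply, Pi.basis_repr,
      Matrix.blockDiagonal'_apply, h, LinearEquiv.apply_symm_apply]
    by_cases hij : i = j
    · subst hij
      simp
    · simp [hij]
  rw [this, Matrix.charpoly_blockDiagonal']
  exact Finset.prod_congr rfl fun i _ => LinearMap.charpoly_toMatrix _ _

/-! ### Schur's lemma for class functions -/

namespace Representation

variable {G V : Type*} [Group G] [Fintype G] [AddCommGroup V] [Module ℂ V]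
  [FiniteDimensional ℂ V]

/-- Conjugation invariance of `f` makes the sum commute with `ρ`, so by Schur's lemma it is a
scalar, which taking traces determines. -/
theorem sum_smul_eq_smul_id_of_isIrreducible (ρ : Representation ℂ G V) [ρ.IsIrreducible]
    (f : G → ℂ) (hf : ∀ g h, f (h * g * h⁻¹) = f g) :
    ∑ g, f g • ρ g = ((∑ g, f g * ρ.character g) / Module.finrank ℂ V) •
      (LinearMap.id : V →ₗ[ℂ] V) := by
  have hcomm : ∀ h, (∑ g, f g • ρ g) ∘ₗ ρ h = ρ h ∘ₗ ∑ g, f g • ρ g := by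
    intro h
    rw [← Module.End.mul_eq_comp, ← Module.End.mul_eq_comp, Finset.sum_mul, Finset.mul_sum,
      ← Equiv.sum_comp (MulAut.conj h).toEquiv]
    refine Finset.sum_congr rfl fun g _ => ?_
    have : (MulAut.conj h).toEquiv g = h * g * h⁻¹ := rfl
    rw [this, hf, smul_mul_assoc, mul_smul_comm, ← map_mul, ← map_mul]
    simp
  let T : IntertwiningMap ρ ρ := ⟨∑ g, f g • ρ g, hcomm⟩
  obtain ⟨c, hc⟩ :=
    (IsIrreducible.algebraMap_intertwiningMap_bijective_of_isAlgClosed (ρ := ρ)).2 T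
  have hT : ∑ g, f g • ρ g = c • (LinearMap.id : V →ₗ[ℂ] V) :=
    (congrArg IntertwiningMap.toLinearMap hc).symm
  have htr := congrArg (LinearMap.trace ℂ V) hT
  rw [map_sum, map_smul, LinearMap.trace_id] at htr
  -- Dividing by the dimension needs `V ≠ 0`: the zero space has a single subrepresentation, whereas
  -- irreducibility provides two.
  have hV : Nontrivial V := by
    by_contra hn
    rw [not_nontrivial_iff_subsingleton] at hn
    obtain ⟨a, b, hab⟩ := (inferInstance : Nontrivial (Subrepresentation ρ))
    exact hab (SetLike.ext fun x => by
      rw [Subsingleton.elim x 0]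
      exact ⟨fun _ => b.toSubmodule.zero_mem, fun _ => a.toSubmodule.zero_mem⟩)
  have hd : (Module.finrank ℂ V : ℂ) ≠ 0 := by
    exact_mod_cast (Module.finrank_pos (R := ℂ) (M := V)).ne'
  rw [hT]
  congr 1
  rw [eq_div_iff hd, ← smul_eq_mul c, ← htr]
  simp [character]

end Representation

namespace Representation

variable {G V W : Type*} [Group G] [AddCommGroup V] [Module ℂ V] [AddCommGroup W] [Module ℂ W]

theorem IsIrreducible.of_equiv {ρ : Representation ℂ G V} {σ : Representation ℂ G W}
    (e : ρ.Equiv σ) (h : ρ.IsIrreducible) : σ.IsIrreducible := by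
  rw [irreducible_iff_isSimpleModule_asModule] at h ⊢
  let f := IntertwiningMap.equivLinearMapAsModule σ ρ e.symm.toIntertwiningMap
  have hf : Function.Bijective f := e.symm.toLinearEquiv.bijective
  exact IsSimpleModule.congr (LinearEquiv.ofBijective f hf)

/-- Transport of a representation along a linear equivalence. -/
noncomputable def conjLinearEquiv (ρ : Representation ℂ G V) (e : V ≃ₗ[ℂ] W) :
    Representation ℂ G W where
  toFun g := e.toLinearMap ∘ₗ ρ g ∘ₗ e.symm.toLinearMap
  map_one' := by ext; simp
  map_mul' g h := by ext; simp

/-- `ρ` is equivalent to its transport along a linear equivalence. -/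
noncomputable def equivConjLinearEquiv (ρ : Representation ℂ G V) (e : V ≃ₗ[ℂ] W) :
    ρ.Equiv (ρ.conjLinearEquiv e) :=
  Equiv.mk e fun g => by ext; simp [conjLinearEquiv]

end Representation

/-! ### Decomposition into irreducibles and the regular representation -/

namespace RingWalk

open Representation

variable {G : Type*} [Group G]

instance Irr.isIrreducible_rep (c : Irr G) : c.rep.IsIrreducible := (Quotient.out c).2

theorem Irr.eq_of_equiv {c d : Irr G} (h : Nonempty (c.rep.Equiv d.rep)) : c = d :=
  Quotient.out_equiv_out.mp h

/-- `Irr` is built only from coordinate spaces; a basis of `V` transports `ρ` to one of them. -/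
theorem exists_irr_equiv {V : Type*} [AddCommGroup V] [Module ℂ V] [FiniteDimensional ℂ V]
    (ρ : Representation ℂ G V) (h : ρ.IsIrreducible) : ∃ c : Irr G, Nonempty (ρ.Equiv c.rep) := by
  let e := (Module.finBasis ℂ V).equivFun
  let p : IrrRep G := ⟨⟨_, ρ.conjLinearEquiv e⟩, h.of_equiv (ρ.equivConjLinearEquiv e)⟩
  obtain ⟨f⟩ : Nonempty (Equiv (Quotient.out (Quotient.mk (irrSetoid G) p)).1.2 p.1.2) :=
    Quotient.mk_out p
  exact ⟨Quotient.mk _ p, ⟨(ρ.equivConjLinearEquiv e).trans f.symm⟩⟩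

open scoped MonoidAlgebra

/-- The representation of `G` on a module over the group algebra. -/
noncomputable def moduleRep (S : Type*) [AddCommGroup S] [Module ℂ S] [Module ℂ[G] S]
    [IsScalarTower ℂ ℂ[G] S] : Representation ℂ G S :=
  (Algebra.lsmul ℂ ℂ S : ℂ[G] →ₐ[ℂ] Module.End ℂ S).toMonoidHom.comp (MonoidAlgebra.of ℂ G)

theorem moduleRep_apply (S : Type*) [AddCommGroup S] [Module ℂ S] [Module ℂ[G] S]
    [IsScalarTower ℂ ℂ[G] S] (g : G) (s : S) :
    moduleRep S g s = MonoidAlgebra.single g (1 : ℂ) • s := rfl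

theorem moduleRep_isIrreducible (S : Type*) [AddCommGroup S] [Module ℂ S] [Module ℂ[G] S]
    [IsScalarTower ℂ ℂ[G] S] [IsSimpleModule ℂ[G] S] : (moduleRep (G := G) S).IsIrreducible := by
  rw [irreducible_iff_isSimpleModule_asModule]
  let f : (moduleRep (G := G) S).asModule →ₗ[ℂ[G]] S :=
    { toFun := (moduleRep (G := G) S).asModuleEquiv
      map_add' := map_add _
      map_smul' := fun r x => by
        rw [asModuleEquiv_map_smul]
        induction r using MonoidAlgebra.induction_linear with
        | zero => simp
        | add a b ha hb =>
          rw [map_add, LinearMap.add_apply, ha, hb, RingHom.id_apply, RingHom.id_apply,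
            RingHom.id_apply, add_smul]
        | single g a =>
          rw [asAlgebraHom_single, LinearMap.smul_apply, moduleRep_apply, RingHom.id_apply,
            ← smul_assoc, MonoidAlgebra.smul_single, smul_eq_mul, mul_one] }
  exact IsSimpleModule.congr
    (LinearEquiv.ofBijective f (moduleRep (G := G) S).asModuleEquiv.bijective)

/-- Maschke's theorem: `ρ` is a semisimple module over the group algebra, hence a finite direct sum
of simple ones, and each of these has a class in `Irr`. -/
theorem exists_linearEquiv_pi_irr [Finite G] {W : Type*} [AddCommGroup W] [Module ℂ W]
    [FiniteDimensional ℂ W] (ρ : Representation ℂ G W) :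
    ∃ (n : ℕ) (cls : Fin n → Irr G) (e : W ≃ₗ[ℂ] ∀ i, (Fin (cls i).dim → ℂ)),
      ∀ g w i, e (ρ g w) i = (cls i).rep g (e w i) := by
  have : NeZero (Nat.card G : ℂ) := ⟨by exact_mod_cast Nat.card_pos.ne'⟩
  have : Module.Finite ℂ[G] ρ.asModule := Module.Finite.of_restrictScalars_finite ℂ _ _
  obtain ⟨n, S, e, hS⟩ := IsSemisimpleModule.exists_linearEquiv_fin_dfinsupp ℂ[G] ρ.asModule
  have key (i) : ∃ c : Irr G, Nonempty ((moduleRep (G := G) (S i)).Equiv c.rep) := by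
    have := hS i
    have : FiniteDimensional ℂ (S i) :=
      FiniteDimensional.of_injective ((S i).subtype.restrictScalars ℂ) (S i).subtype_injective
    exact exists_irr_equiv _ (moduleRep_isIrreducible (S i))
  choose cls f using key
  let f' := fun i => (f i).some
  let e₁ : ρ.asModule ≃ₗ[ℂ[G]] ∀ i, S i := e.trans DFinsupp.linearEquivFunOnFintype
  refine ⟨n, cls, ρ.asModuleEquiv.symm.trans ((e₁.restrictScalars ℂ).trans
    (LinearEquiv.piCongrRight fun i => (f' i).toLinearEquiv)), fun g w i => ?_⟩
  change f' i (e₁ (ρ.asModuleEquiv.symm (ρ g w)) i) =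
    (cls i).rep g (f' i (e₁ (ρ.asModuleEquiv.symm w) i))
  rw [asModuleEquiv_symm_map_rho, map_smul]
  exact (f' i).toIntertwiningMap.isIntertwining _ _ g _

theorem finrank_intertwiningMap_irr [DecidableEq (Irr G)] (c d : Irr G) :
    Module.finrank ℂ (IntertwiningMap c.rep d.rep) = if c = d then 1 else 0 := by
  split_ifs with h
  · subst h
    simp
  · have : IsEmpty (c.rep.Equiv d.rep) :=
      ⟨fun e => h (Irr.eq_of_equiv ⟨e⟩)⟩
    exact Module.finrank_zero_of_subsingleton

/-- An intertwining map out of a direct sum is a family of maps out of the summands, and by Schur's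
lemma a summand contributes dimension one or zero. -/
theorem card_eq_finrank_intertwiningMap [DecidableEq (Irr G)] {W : Type*} [AddCommGroup W]
    [Module ℂ W] (ρ : Representation ℂ G W) {n : ℕ} (cls : Fin n → Irr G)
    (e : W ≃ₗ[ℂ] ∀ i, (Fin (cls i).dim → ℂ))
    (he : ∀ g w i, e (ρ g w) i = (cls i).rep g (e w i)) (c : Irr G) :
    (Finset.univ.filter fun i => cls i = c).card =
      Module.finrank ℂ (IntertwiningMap ρ c.rep) := by
  have hs (g : G) (i : Fin n) (v) : e.symm (Pi.single i ((cls i).rep g v)) =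
      ρ g (e.symm (Pi.single i v)) := by
    rw [LinearEquiv.symm_apply_eq]
    ext1 j
    rw [he, LinearEquiv.apply_symm_apply]
    by_cases h : j = i
    · subst h
      simp
    · simp [Pi.single_eq_of_ne h]
  let E : IntertwiningMap ρ c.rep ≃ₗ[ℂ] ∀ i, IntertwiningMap (cls i).rep c.rep :=
    { toFun := fun T i =>
        ⟨T.toLinearMap ∘ₗ e.symm.toLinearMap ∘ₗ
          LinearMap.single ℂ (fun i => Fin (cls i).dim → ℂ) i, fun g => by
          refine LinearMap.ext fun v => ?_
          change T (e.symm (Pi.single i ((cls i).rep g v))) = c.rep g (T (e.symm (Pi.single i v)))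
          rw [hs, T.isIntertwining]⟩
      invFun := fun T =>
        ⟨∑ i, (T i).toLinearMap ∘ₗ LinearMap.proj i ∘ₗ e.toLinearMap, fun g => by
          ext1 v
          simp only [LinearMap.comp_apply, LinearMap.sum_apply, map_sum]
          refine Finset.sum_congr rfl fun i _ => ?_
          change T i (e (ρ g v) i) = c.rep g (T i (e v i))
          rw [he, (T i).isIntertwining]⟩
      map_add' := fun S T => rfl
      map_smul' := fun a T => rfl
      left_inv := fun T => by
        refine IntertwiningMap.ext (LinearMap.ext fun v => ?_)
        simp only [LinearMap.comp_apply, LinearMap.sum_apply]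
        change ∑ i, T (e.symm (Pi.single i (e v i))) = T v
        rw [← map_sum, ← map_sum, Finset.univ_sum_single, LinearEquiv.symm_apply_apply]
      right_inv := fun T => by
        refine funext fun j => IntertwiningMap.ext (LinearMap.ext fun v => ?_)
        simp only [LinearMap.comp_apply, LinearMap.sum_apply]
        change ∑ i, T i (e (e.symm (Pi.single j v)) i) = T j v
        rw [LinearEquiv.apply_symm_apply, Finset.sum_eq_single j]
        · simp
        · intro i _ h
          rw [Pi.single_eq_of_ne h, map_zero]
        · simp }
  have hfin (i) : FiniteDimensional ℂ (IntertwiningMap (cls i).rep c.rep) := inferInstance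
  rw [E.finrank_eq, Module.finrank_pi_fintype, Finset.card_filter]
  exact Finset.sum_congr rfl fun i _ => (finrank_intertwiningMap_irr _ _).symm

/-- The permutation representation on the functions on a `G`-set. -/
noncomputable def permRep (G : Type*) [Group G] (X : Type*) [MulAction G X] :
    Representation ℂ G (X → ℂ) where
  toFun g := LinearMap.funLeft ℂ ℂ fun x => g⁻¹ • x
  map_one' := by ext; simp [LinearMap.funLeft_apply]
  map_mul' g h := by
    refine LinearMap.ext fun f => funext fun x => ?_
    simp [LinearMap.funLeft_apply, mul_smul]

theorem permRep_apply {X : Type*} [MulAction G X] (g : G) (f : X → ℂ) (x : X) :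
    permRep G X g f x = f (g⁻¹ • x) := rfl

theorem permRep_single {X : Type*} [MulAction G X] [DecidableEq X] (g : G) (x : X) (a : ℂ) :
    permRep G X g (Pi.single x a) = Pi.single (g • x) a := by
  ext y
  rw [permRep_apply, Pi.single_apply, Pi.single_apply]
  simp only [inv_smul_eq_iff]

/-- Rows of `M` are indexed by the starting point, while the operator sends the indicator of `x` to
that of `g • x`. The two matrices are therefore transposes of each other. -/
theorem charpoly_sum_permRep [Fintype G] {X : Type*} [MulAction G X] [Fintype X] [DecidableEq X]
    (f : G → ℂ) (M : Matrix X X ℂ) (hM : ∀ x y, M x y = ∑ g : G with g • x = y, f g) :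
    M.charpoly = (∑ g, f g • permRep G X g).charpoly := by
  rw [← Matrix.charpoly_transpose, ← Matrix.charpoly_toLin']
  congr 1
  refine LinearMap.pi_ext' fun x => LinearMap.ext_ring ?_
  ext y
  simp only [LinearMap.comp_apply, LinearMap.single_apply, LinearMap.sum_apply,
    LinearMap.smul_apply, permRep_single, Finset.sum_apply, Pi.smul_apply, Pi.single_apply,
    smul_eq_mul, Matrix.toLin'_apply, Matrix.mulVec_single_one, Matrix.col_apply,
    Matrix.transpose_apply, hM, Finset.sum_filter]
  refine Finset.sum_congr rfl fun g _ => ?_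
  simp [eq_comm]

/-- The indicator of `1` freely generates the functions on `G`, so an intertwining map amounts to an
arbitrary choice of its image. -/
theorem finrank_intertwiningMap_permRep_self [Finite G] {V : Type*} [AddCommGroup V] [Module ℂ V]
    (ρ : Representation ℂ G V) :
    Module.finrank ℂ (IntertwiningMap (permRep G G) ρ) = Module.finrank ℂ V := by
  classical
  have := Fintype.ofFinite G
  let E : IntertwiningMap (permRep G G) ρ ≃ₗ[ℂ] V :=
    { toFun := fun T => T (Pi.single 1 1)
      invFun := fun v => ⟨∑ g, (LinearMap.proj g).smulRight (ρ g v), fun h => by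
          refine LinearMap.ext fun f => ?_
          simp only [LinearMap.comp_apply, LinearMap.sum_apply, map_sum,
            LinearMap.smulRight_apply, LinearMap.proj_apply, permRep_apply, map_smul]
          rw [← Equiv.sum_comp (Equiv.mulLeft h)]
          simp⟩
      map_add' := fun S T => rfl
      map_smul' := fun a T => rfl
      left_inv := fun T => by
        ext1
        refine LinearMap.pi_ext' fun x => LinearMap.ext_ring ?_
        simp only [LinearMap.comp_apply, LinearMap.sum_apply, LinearMap.single_apply,
            LinearMap.smulRight_apply, LinearMap.proj_apply, ← T.isIntertwining, permRep_single]
        rw [Finset.sum_eq_single x]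
        · simp
        · intro y _ hy
          simp [Pi.single_eq_of_ne hy]
        · simp
      right_inv := fun v => by
        change (∑ g, (LinearMap.proj g : (G → ℂ) →ₗ[ℂ] ℂ).smulRight (ρ g v)) (Pi.single 1 1) = v
        simp only [LinearMap.sum_apply, LinearMap.smulRight_apply, LinearMap.proj_apply]
        rw [Finset.sum_eq_single 1]
        · simp
        · intro y _ hy
          simp [Pi.single_eq_of_ne hy]
        · simp }
  exact E.finrank_eq

theorem exists_regular_decomposition [Fintype G] [DecidableEq (Irr G)] :
    ∃ (n : ℕ) (cls : Fin n → Irr G) (e : (G → ℂ) ≃ₗ[ℂ] ∀ i, (Fin (cls i).dim → ℂ)),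
      (∀ g w i, e (permRep G G g w) i = (cls i).rep g (e w i)) ∧
      ∀ c, (Finset.univ.filter fun i => cls i = c).card = c.dim := by
  obtain ⟨n, cls, e, he⟩ := exists_linearEquiv_pi_irr (permRep G G)
  refine ⟨n, cls, e, he, fun c => ?_⟩
  rw [card_eq_finrank_intertwiningMap _ cls e he, finrank_intertwiningMap_permRep_self]
  simp

theorem Irr.dim_pos (c : Irr G) : 0 < c.dim := by
  rw [Nat.pos_iff_ne_zero]
  intro h
  obtain ⟨a, b, hab⟩ := (inferInstance : Nontrivial (Subrepresentation c.rep))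
  have : Subsingleton (Fin c.dim → ℂ) := by
    rw [h]
    infer_instance
  exact hab (SetLike.ext fun x => by
    rw [Subsingleton.elim x 0]
    exact ⟨fun _ => b.toSubmodule.zero_mem, fun _ => a.toSubmodule.zero_mem⟩)

/-- Every class has positive dimension, so it occurs among the finitely many summands of the regular
representation. -/
instance Irr.finite [Finite G] : Finite (Irr G) := by
  classical
  have := Fintype.ofFinite G
  obtain ⟨n, cls, e, -, hm⟩ := exists_regular_decomposition (G := G)
  refine Finite.of_surjective cls fun c => ?_
  have := hm c ▸ c.dim_pos
  obtain ⟨i, hi⟩ := Finset.card_pos.mp this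
  exact ⟨i, (Finset.mem_filter.mp hi).2⟩

theorem finsum_dim_sq [Fintype G] : ∑ᶠ c : Irr G, c.dim ^ 2 = Fintype.card G := by
  classical
  have := Fintype.ofFinite (Irr G)
  obtain ⟨n, cls, e, -, hm⟩ := exists_regular_decomposition (G := G)
  have h := e.finrank_eq
  rw [Module.finrank_fintype_fun_eq_card, Module.finrank_pi_fintype] at h
  rw [finsum_eq_sum_of_fintype, h, ← Finset.sum_fiberwise Finset.univ cls]
  refine Finset.sum_congr rfl fun c _ => ?_
  rw [Finset.sum_congr rfl (g := fun _ => c.dim), Finset.sum_const, hm, sq, smul_eq_mul]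
  intro i hi
  rw [← (Finset.mem_filter.mp hi).2]
  simp

/-- The square in the exponent has two sources: `c.dim` copies of the summand, each a scalar block
of size `c.dim`. -/
theorem charpoly_sum_regular [Fintype G] (f : G → ℂ) (hf : ∀ g h, f (h * g * h⁻¹) = f g) :
    (∑ g, f g • permRep G G g).charpoly =
      ∏ᶠ c : Irr G, (X - C ((∑ g, f g * c.rep.character g) / c.dim)) ^ (c.dim ^ 2) := by
  classical
  have := Fintype.ofFinite (Irr G)
  obtain ⟨n, cls, e, he, hm⟩ := exists_regular_decomposition (G := G)
  rw [LinearMap.charpoly_eq_prod_of_equiv_pi e _ (fun i => ∑ g, f g • (cls i).rep g),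
    finprod_eq_prod_of_fintype, ← Finset.prod_fiberwise Finset.univ cls]
  · refine Finset.prod_congr rfl fun c _ => ?_
    rw [Finset.prod_congr rfl
      (g := fun _ => (X - C ((∑ g, f g * c.rep.character g) / c.dim)) ^ c.dim),
      Finset.prod_const, hm, sq, pow_mul]
    intro i hi
    rw [← (Finset.mem_filter.mp hi).2, sum_smul_eq_smul_id_of_isIrreducible _ f hf,
      LinearMap.charpoly_smul_id, Module.finrank_fin_fun]
  · intro w i
    simp only [LinearMap.sum_apply, LinearMap.smul_apply, map_sum, map_smul, Finset.sum_apply,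
      Pi.smul_apply, he]

end RingWalk

/-! ### Induced representations, complements and a criterion for irreducibility -/

namespace Representation

section Induced

variable {G : Type*} [Group G] {H : Subgroup G} {A B : Type*} [AddCommGroup A] [Module ℂ A]
  [AddCommGroup B] [Module ℂ B]

/-- The linear map `a ↦ ⟦g ⊗ a⟧` into an induced representation. -/
noncomputable def indMk (σ : Representation ℂ H A) (g : G) : A →ₗ[ℂ] IndV H.subtype σ :=
  IndV.mk H.subtype σ g

theorem ind_indMk (σ : Representation ℂ H A) (g h : G) (a : A) :
    ind H.subtype σ g (indMk σ h a) = indMk σ (h * g⁻¹) a := ind_mk _ _ _ _ _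

theorem indMk_induction {σ : Representation ℂ H A} {p : Submodule ℂ (IndV H.subtype σ)}
    (hp : ∀ g a, indMk σ g a ∈ p) : p = ⊤ := by
  rw [← Submodule.ker_mkQ p, LinearMap.ker_eq_top]
  refine IndV.hom_ext _ _ fun g => LinearMap.ext fun a => ?_
  exact (Submodule.Quotient.mk_eq_zero p).mpr (hp g a)

/-- This is the relation that defines the coinvariants: `H` multiplies the group index on the left,
while `G` acts on it by right translation. -/
theorem indMk_mul (σ : Representation ℂ H A) (b : H) (g : G) (a : A) :
    indMk σ ((b : G) * g) (σ b a) = indMk σ g a := by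
  have := Coinvariants.mk_self_apply
    (Representation.tprod ((leftRegular ℂ G).comp H.subtype) σ) b
    (TensorProduct.tmul ℂ (MonoidAlgebra.single g 1) a)
  simpa [indMk] using this

/-- The intertwining map out of an induced representation given by Frobenius reciprocity. -/
noncomputable def indLift (σ : Representation ℂ H A) (τ : Representation ℂ G B) (f : A →ₗ[ℂ] B)
    (hf : ∀ (b : H) a, f (σ b a) = τ b (f a)) : IntertwiningMap (ind H.subtype σ) τ where
  toLinearMap := Coinvariants.lift _
    (TensorProduct.lift <| (Finsupp.lift _ _ _ fun g => τ g⁻¹ ∘ₗ f) ∘ₗ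
      (MonoidAlgebra.coeffLinearEquiv ℂ).toLinearMap)
    fun b => by
      ext g a
      simp [hf]
  isIntertwining' g := by ext; simp

theorem indLift_mk (σ : Representation ℂ H A) (τ : Representation ℂ G B) (f : A →ₗ[ℂ] B)
    (hf : ∀ (b : H) a, f (σ b a) = τ b (f a)) (g : G) (a : A) :
    indLift σ τ f hf (indMk σ g a) = τ g⁻¹ (f a) := by
  change (indLift σ τ f hf).toLinearMap _ = _
  simp [indLift, indMk]

variable {X : Type*} [MulAction G X] [Fintype X] [DecidableEq X] [MulAction.IsPretransitive G X]

/-- The intertwining map from the functions on a transitive `G`-set to a representation induced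
from a character that is trivial on the stabilizer of `x₀`; it sends the indicator function of
`g • x₀` to the class of `g`. -/
noncomputable def permRepToInd (σ : Representation ℂ H ℂ) (x₀ : X)
    (h₀ : ∀ g : G, g • x₀ = x₀ → ∃ h : g ∈ H, σ ⟨g, h⟩ 1 = 1) :
    IntertwiningMap (permRep G X) (ind H.subtype σ) :=
  -- Well-definedness: `g⁻¹ g'` fixes `x₀`, so it lies in `H` with character value one and can be
  -- absorbed by the coinvariance relation.
  have key (g g' : G) (h : g • x₀ = g' • x₀) :
      indMk σ g⁻¹ 1 = indMk σ g'⁻¹ 1 := by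
    obtain ⟨hm, h1⟩ := h₀ (g⁻¹ * g') (by rw [mul_smul, ← h, inv_smul_smul])
    rw [← indMk_mul σ ⟨_, hm⟩ g'⁻¹, h1]
    simp
  { toLinearMap := ∑ x : X, (LinearMap.proj x).smulRight
      (indMk σ (MulAction.exists_smul_eq G x₀ x).choose⁻¹ 1)
    isIntertwining' := fun g => by
      refine LinearMap.pi_ext' fun x => LinearMap.ext_ring ?_
      simp only [LinearMap.comp_apply, LinearMap.single_apply, permRep_single,
        LinearMap.sum_apply, LinearMap.smulRight_apply, LinearMap.proj_apply, map_sum, map_smul]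
      rw [Finset.sum_eq_single (g • x), Finset.sum_eq_single x]
      · rw [Pi.single_eq_same, Pi.single_eq_same, one_smul, one_smul, ind_indMk, ← _root_.mul_inv_rev]
        apply key
        rw [mul_smul, (MulAction.exists_smul_eq G x₀ x).choose_spec,
          (MulAction.exists_smul_eq G x₀ (g • x)).choose_spec]
      · intro y _ hy
        simp [Pi.single_eq_of_ne hy]
      · simp
      · intro y _ hy
        simp [Pi.single_eq_of_ne hy]
      · simp }

/-- The inverse appears because `G` acts on the index of a class through right multiplication by the
inverse. -/
theorem permRepToInd_single (σ : Representation ℂ H ℂ) (x₀ : X)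
    (h₀ : ∀ g : G, g • x₀ = x₀ → ∃ h : g ∈ H, σ ⟨g, h⟩ 1 = 1) (g : G) :
    permRepToInd σ x₀ h₀ (Pi.single (g • x₀) 1) = indMk σ g⁻¹ 1 := by
  have h1 : permRepToInd σ x₀ h₀ (Pi.single x₀ 1) = indMk σ 1 1 := by
    change (∑ x : X, (LinearMap.proj x : (X → ℂ) →ₗ[ℂ] ℂ).smulRight
      (indMk σ (MulAction.exists_smul_eq G x₀ x).choose⁻¹ 1)) (Pi.single x₀ 1) = _
    simp only [LinearMap.sum_apply, LinearMap.smulRight_apply, LinearMap.proj_apply]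
    rw [Finset.sum_eq_single x₀]
    · obtain ⟨hm, h1⟩ := h₀ _ (MulAction.exists_smul_eq G x₀ x₀).choose_spec
      rw [Pi.single_eq_same, one_smul, ← indMk_mul σ ⟨_, hm⟩, h1]
      simp
    · intro y _ hy
      simp [Pi.single_eq_of_ne hy]
    · simp
  rw [← permRep_single, IntertwiningMap.isIntertwining, h1, ind_indMk, one_mul]

theorem permRepToInd_surjective (σ : Representation ℂ H ℂ) (x₀ : X)
    (h₀ : ∀ g : G, g • x₀ = x₀ → ∃ h : g ∈ H, σ ⟨g, h⟩ 1 = 1) :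
    Function.Surjective (permRepToInd σ x₀ h₀) := by
  rw [← IntertwiningMap.coe_toLinearMap, ← LinearMap.range_eq_top]
  refine indMk_induction fun g a => ⟨a • Pi.single (g⁻¹ • x₀) 1, ?_⟩
  rw [map_smul]
  refine (congrArg (a • ·) (permRepToInd_single σ x₀ h₀ g⁻¹)).trans ?_
  rw [inv_inv, ← map_smul, smul_eq_mul, mul_one]

end Induced

section Complement

variable {G V : Type*} [Group G] [AddCommGroup V] [Module ℂ V] {ρ : Representation ℂ G V}

theorem _root_.Subrepresentation.isCompl_toSubmodule {N N' : Subrepresentation ρ}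
    (h : IsCompl N N') : IsCompl N.toSubmodule N'.toSubmodule :=
  ⟨disjoint_iff.mpr (congrArg Subrepresentation.toSubmodule h.inf_eq_bot),
    codisjoint_iff.mpr (congrArg Subrepresentation.toSubmodule h.sup_eq_top)⟩

/-- The equivariant projection onto a subrepresentation along a complement. -/
noncomputable def _root_.Subrepresentation.projection {N N' : Subrepresentation ρ}
    (h : IsCompl N N') : IntertwiningMap ρ N.toRepresentation where
  toLinearMap := Submodule.projectionOnto _ _ (Subrepresentation.isCompl_toSubmodule h)
  isIntertwining' g := by
    have hc := Subrepresentation.isCompl_toSubmodule h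
    refine LinearMap.ext fun v => ?_
    obtain ⟨a, ha, b, hb, rfl⟩ := Submodule.mem_sup.mp
      (hc.sup_eq_top ▸ Submodule.mem_top : v ∈ N.toSubmodule ⊔ N'.toSubmodule)
    simp only [LinearMap.comp_apply, map_add]
    rw [Submodule.projectionOnto_apply_of_mem_left hc ha,
      Submodule.projectionOnto_apply_of_mem_left hc (N.apply_mem_toSubmodule g ha),
      Submodule.projectionOnto_apply_of_mem_right hc hb,
      Submodule.projectionOnto_apply_of_mem_right hc (N'.apply_mem_toSubmodule g hb), map_zero]
    rfl

theorem _root_.Subrepresentation.projection_of_mem {N N' : Subrepresentation ρ}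
    (h : IsCompl N N') {v : V} (hv : v ∈ N.toSubmodule) :
    Subrepresentation.projection h v = (⟨v, hv⟩ : N.toSubmodule) :=
  Submodule.projectionOnto_apply_of_mem_left _ hv

theorem _root_.Subrepresentation.projection_eq_zero_iff {N N' : Subrepresentation ρ}
    (h : IsCompl N N') {v : V} :
    Subrepresentation.projection h v = 0 ↔ v ∈ N'.toSubmodule :=
  Submodule.projectionOnto_apply_eq_zero_iff (Subrepresentation.isCompl_toSubmodule h)

/-- The equivariant inclusion of a subrepresentation. -/
def _root_.Subrepresentation.inclusion (N : Subrepresentation ρ) :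
    IntertwiningMap N.toRepresentation ρ where
  toLinearMap := N.toSubmodule.subtype
  isIntertwining' _ := rfl

theorem _root_.Subrepresentation.inclusion_apply (N : Subrepresentation ρ) (v : N.toSubmodule) :
    N.inclusion v = (v : V) := rfl

/-- A subrepresentation has a complement by Maschke's theorem, and the projection onto it is an
endomorphism, hence a scalar `c`. It is the zero space if `c = 0` and everything otherwise. -/
theorem IsIrreducible.of_forall_exists_smul [Finite G] [Nontrivial V]
    (h : ∀ T : IntertwiningMap ρ ρ, ∃ c : ℂ, ∀ v, T v = c • v) : ρ.IsIrreducible := by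
  have : NeZero (Nat.card G : ℂ) := ⟨by exact_mod_cast Nat.card_pos.ne'⟩
  have hnt : Nontrivial (Subrepresentation ρ) := by
    refine ⟨⊥, ⊤, fun h => ?_⟩
    obtain ⟨v, hv⟩ := exists_ne (0 : V)
    have hv' : v ∈ (⊤ : Subrepresentation ρ) := Submodule.mem_top (R := ℂ)
    rw [← h] at hv'
    exact hv ((Submodule.mem_bot ℂ).mp hv')
  refine ⟨fun N => ?_⟩
  obtain ⟨N', hN⟩ := exists_isCompl N
  obtain ⟨c, hc⟩ := h (N.inclusion.comp (Subrepresentation.projection hN))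
  by_cases h0 : c = 0
  · left
    refine le_bot_iff.mp fun v hv => ?_
    have := hc v
    rw [IntertwiningMap.comp_apply, Subrepresentation.projection_of_mem hN hv,
      Subrepresentation.inclusion_apply, h0, zero_smul] at this
    exact (Submodule.mem_bot ℂ).mpr this
  · right
    refine top_le_iff.mp fun v _ => ?_
    have hv : c • v ∈ N.toSubmodule := hc v ▸ (Subrepresentation.projection hN v).2
    exact (Submodule.smul_mem_iff _ h0).mp hv

end Complement

end Representation

/-! ### The permutation representation on the nonzero vectors -/

namespace RingWalk

open Representation

/-- The nonzero vectors of `F²`. -/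
abbrev PuncturedPlane (F : Type*) [Field F] := {v : Fin 2 → F // v ≠ 0}

namespace PuncturedPlane

variable {F : Type*} [Field F]

theorem mulVec_ne_zero (g : GL (Fin 2) F) {v : Fin 2 → F} (hv : v ≠ 0) :
    (g : Matrix (Fin 2) (Fin 2) F) *ᵥ v ≠ 0 := by
  intro h
  apply hv
  have : ((g⁻¹ : GL (Fin 2) F) : Matrix (Fin 2) (Fin 2) F) *ᵥ
      ((g : Matrix (Fin 2) (Fin 2) F) *ᵥ v) = 0 := by rw [h, Matrix.mulVec_zero]
  rwa [Matrix.mulVec_mulVec, ← Units.val_mul, inv_mul_cancel, Units.val_one,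
    Matrix.one_mulVec] at this

instance : MulAction (GL (Fin 2) F) (PuncturedPlane F) where
  smul g v := ⟨(g : Matrix (Fin 2) (Fin 2) F) *ᵥ v.1, mulVec_ne_zero g v.2⟩
  one_smul v := Subtype.ext (Matrix.one_mulVec v.1)
  mul_smul g h v := Subtype.ext (Matrix.mulVec_mulVec v.1 g.1 h.1).symm

theorem coe_smul (g : GL (Fin 2) F) (v : PuncturedPlane F) :
    ((g • v : PuncturedPlane F) : Fin 2 → F) = (g : Matrix (Fin 2) (Fin 2) F) *ᵥ v.1 := rfl

instance : MulAction Fˣ (PuncturedPlane F) where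
  smul t v := ⟨(t : F) • v.1, smul_ne_zero t.ne_zero v.2⟩
  one_smul v := Subtype.ext (one_smul F v.1)
  mul_smul s t v := Subtype.ext (mul_smul (s : F) (t : F) v.1)

theorem coe_units_smul (t : Fˣ) (v : PuncturedPlane F) :
    ((t • v : PuncturedPlane F) : Fin 2 → F) = (t : F) • v.1 := rfl

instance : SMulCommClass (GL (Fin 2) F) Fˣ (PuncturedPlane F) where
  smul_comm g t v := Subtype.ext (Matrix.mulVec_smul g.1 (t : F) v.1)

theorem units_smul_eq_self_iff (t : Fˣ) (v : PuncturedPlane F) : t • v = v ↔ t = 1 := by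
  refine ⟨fun h => ?_, fun h => by rw [h, one_smul]⟩
  obtain ⟨i, hi⟩ := Function.ne_iff.mp v.2
  have := congrFun (congrArg Subtype.val h) i
  rw [coe_units_smul, Pi.smul_apply, smul_eq_mul] at this
  exact Units.ext (mul_right_cancel₀ hi (this.trans (one_mul _).symm))

/-- The vector `(1, 0)`. -/
def base (F : Type*) [Field F] : PuncturedPlane F :=
  ⟨![1, 0], fun h => one_ne_zero (congrFun h 0)⟩

theorem exists_smul_base_eq (v : PuncturedPlane F) : ∃ g : GL (Fin 2) F, g • base F = v := by
  obtain ⟨v, hv⟩ := v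
  by_cases h : v 0 = 0
  · have h1 : v 1 ≠ 0 := fun h1 => hv (funext fun i => by fin_cases i <;> simp [h, h1])
    refine ⟨Matrix.GeneralLinearGroup.mkOfDetNeZero !![v 0, 1; v 1, 0]
      (by simp [Matrix.det_fin_two, h1]), Subtype.ext ?_⟩
    rw [coe_smul]
    ext i
    fin_cases i <;> simp [base, Matrix.mulVec, dotProduct, Matrix.GeneralLinearGroup.mkOfDetNeZero]
  · refine ⟨Matrix.GeneralLinearGroup.mkOfDetNeZero !![v 0, 0; v 1, 1]
      (by simp [Matrix.det_fin_two, h]), Subtype.ext ?_⟩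
    rw [coe_smul]
    ext i
    fin_cases i <;> simp [base, Matrix.mulVec, dotProduct, Matrix.GeneralLinearGroup.mkOfDetNeZero]

instance : MulAction.IsPretransitive (GL (Fin 2) F) (PuncturedPlane F) where
  exists_smul_eq v w := by
    obtain ⟨g, rfl⟩ := exists_smul_base_eq v
    obtain ⟨h, rfl⟩ := exists_smul_base_eq w
    exact ⟨h * g⁻¹, by rw [smul_smul, inv_mul_cancel_right]⟩

/-- Two vectors that are not proportional are the images of the standard basis vectors. -/
theorem exists_smul_eq_of_forall_ne (v w : PuncturedPlane F) (h : ∀ t : Fˣ, w ≠ t • v) :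
    ∃ g : GL (Fin 2) F, g • base F = v ∧
      g • (⟨![0, 1], fun h => one_ne_zero (congrFun h 1)⟩ : PuncturedPlane F) = w := by
  obtain ⟨g, rfl⟩ := exists_smul_base_eq v
  obtain ⟨w, rfl⟩ := MulAction.surjective g w
  have hw : w.1 1 ≠ 0 := by
    intro h1
    have h0 : w.1 0 ≠ 0 := fun h0 => w.2 (funext fun i => by fin_cases i <;> simp [h0, h1])
    refine h (Units.mk0 _ h0) ?_
    rw [← smul_comm]
    congr 1
    refine Subtype.ext (funext fun i => ?_)
    rw [coe_units_smul]
    fin_cases i <;> simp [base, h1]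
  refine ⟨g * Matrix.GeneralLinearGroup.mkOfDetNeZero !![1, w.1 0; 0, w.1 1]
    (by simp [Matrix.det_fin_two, hw]), ?_, ?_⟩
  · rw [mul_smul]
    congr 1
    refine Subtype.ext (funext fun i => ?_)
    rw [coe_smul]
    fin_cases i <;> simp [base, Matrix.mulVec, dotProduct, Matrix.GeneralLinearGroup.mkOfDetNeZero]
  · rw [mul_smul]
    congr 1
    refine Subtype.ext (funext fun i => ?_)
    rw [coe_smul]
    fin_cases i <;> simp [Matrix.mulVec, dotProduct, Matrix.GeneralLinearGroup.mkOfDetNeZero]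

variable [Fintype F] [DecidableEq F]

theorem card_puncturedPlane : Fintype.card (PuncturedPlane F) = Fintype.card F ^ 2 - 1 := by
  rw [Fintype.card_subtype_compl, Fintype.card_subtype_eq]
  simp

/-- Scalars act freely on nonzero vectors, so a single term of the sum survives. -/
theorem card_orbit_relation (v w : PuncturedPlane F) (f : Fˣ → ℂ) (t : Fˣ) (h : w = t • v) :
    (∑ s, if w = s • v then f s else 0) = f t := by
  rw [Finset.sum_eq_single t]
  · rw [if_pos h]
  · intro s _ hs
    rw [if_neg]
    rintro rfl
    apply hs
    rw [← inv_mul_eq_one, ← units_smul_eq_self_iff _ v, mul_smul, ← h, inv_smul_smul]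
  · simp

/-- The permutation representation on the functions on the nonzero vectors of `F²`. -/
noncomputable abbrev planeRep (F : Type*) [Field F] :
    Representation ℂ (GL (Fin 2) F) (PuncturedPlane F → ℂ) :=
  permRep (GL (Fin 2) F) (PuncturedPlane F)

/-- Every endomorphism of the permutation representation on the nonzero vectors is a combination
of the scalar translations and the sum functional. -/
theorem exists_permRep_endomorphism_eq
    (T : IntertwiningMap (planeRep F) (planeRep F)) :
    ∃ (a : Fˣ → ℂ) (b : ℂ), ∀ f v, T f v = ∑ s, a s * f (s • v) + b * ∑ u, f u := by
  -- The kernel of `T` is constant on orbits of pairs: there is one orbit of pairs `(v, s v)` for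
  -- every `s`, and one orbit of all independent pairs.
  let K (v u : PuncturedPlane F) : ℂ := T (Pi.single u 1) v
  have hK (g : GL (Fin 2) F) (v u) : K (g • v) (g • u) = K v u := by
    change T (Pi.single (g • u) 1) (g • v) = T (Pi.single u 1) v
    rw [← permRep_single, T.isIntertwining, permRep_apply, inv_smul_smul]
  let e₂ : PuncturedPlane F := ⟨![0, 1], fun h => one_ne_zero (congrFun h 1)⟩
  let b := K (base F) e₂
  -- The sum functional already puts `b` on the proportional pairs, hence the subtraction.
  let a : Fˣ → ℂ := fun s => K (base F) (s • base F) - b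
  have key (v u) : K v u = b + ∑ s, if u = s • v then a s else 0 := by
    by_cases h : ∃ t : Fˣ, u = t • v
    · obtain ⟨t, ht⟩ := h
      obtain ⟨g, rfl⟩ := exists_smul_base_eq v
      rw [card_orbit_relation _ _ a t ht, ht, ← smul_comm, hK]
      simp [a]
    · push Not at h
      rw [Finset.sum_eq_zero fun s _ => if_neg (h s), add_zero]
      obtain ⟨g, rfl, rfl⟩ := exists_smul_eq_of_forall_ne v u h
      exact hK _ _ _
  refine ⟨a, b, fun f v => ?_⟩
  have hf : T f v = ∑ u, f u * K v u := by
    conv_lhs => rw [← Finset.univ_sum_single f]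
    rw [map_sum, Finset.sum_apply]
    refine Finset.sum_congr rfl fun u _ => ?_
    have : (Pi.single u (f u) : PuncturedPlane F → ℂ) = f u • Pi.single u 1 := by
      rw [← Pi.single_smul, smul_eq_mul, mul_one]
    rw [this, map_smul, Pi.smul_apply, smul_eq_mul]
  rw [hf]
  simp_rw [key, mul_add, Finset.sum_add_distrib, Finset.mul_sum]
  rw [add_comm, Finset.sum_comm]
  congr 1
  · refine Finset.sum_congr rfl fun s _ => ?_
    simp [mul_comm]
  · simp_rw [mul_comm]

/-- The operator `f ↦ ∑ₛ χ(s) f(s · )`. -/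
noncomputable def charOp (χ : MulChar F ℂ) :
    IntertwiningMap (planeRep F) (planeRep F) where
  toLinearMap := ∑ s : Fˣ, χ s • LinearMap.funLeft ℂ ℂ fun v : PuncturedPlane F => s • v
  isIntertwining' g := by
    refine LinearMap.ext fun f => funext fun v => ?_
    simp only [LinearMap.comp_apply, LinearMap.sum_apply, LinearMap.smul_apply, Finset.sum_apply,
      Pi.smul_apply, LinearMap.funLeft_apply, permRep_apply, smul_comm]

theorem charOp_apply (χ : MulChar F ℂ) (f : PuncturedPlane F → ℂ) (v : PuncturedPlane F) :
    charOp χ f v = ∑ s : Fˣ, χ s * f (s • v) := by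
  change (∑ s : Fˣ, χ s • LinearMap.funLeft ℂ ℂ fun v : PuncturedPlane F => s • v) f v = _
  simp [LinearMap.funLeft_apply]

theorem charOp_apply_smul (χ : MulChar F ℂ) (f : PuncturedPlane F → ℂ) (t : Fˣ)
    (v : PuncturedPlane F) : charOp χ f (t • v) = (χ t)⁻¹ * charOp χ f v := by
  rw [charOp_apply, charOp_apply, Finset.mul_sum, ← Equiv.sum_comp (Equiv.mulRight t⁻¹)]
  refine Finset.sum_congr rfl fun s _ => ?_
  have ht : χ ((t⁻¹ : Fˣ) : F) = (χ t)⁻¹ := by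
    rw [Units.val_inv_eq_inv_val, ← MulChar.inv_apply', MulChar.inv_apply_eq_inv']
  rw [Equiv.coe_mulRight, Units.val_mul, map_mul, ht, smul_smul, inv_mul_cancel_right]
  ring

theorem charOp_single_smul (χ : MulChar F ℂ) (t : Fˣ) (v : PuncturedPlane F) :
    charOp χ (Pi.single (t • v) 1) = χ t • charOp χ (Pi.single v 1) := by
  ext w
  rw [Pi.smul_apply, charOp_apply, charOp_apply, ← Equiv.sum_comp (Equiv.mulLeft t), smul_eq_mul,
    Finset.mul_sum]
  refine Finset.sum_congr rfl fun s _ => ?_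
  rw [Equiv.coe_mulLeft, Units.val_mul, map_mul, mul_smul, Pi.single_apply, Pi.single_apply]
  simp only [smul_left_cancel_iff]
  ring

theorem sum_mulChar_eq_zero {χ : MulChar F ℂ} (h : χ ≠ 1) : ∑ s : Fˣ, χ s = 0 := by
  obtain ⟨t, ht⟩ := MulChar.ne_one_iff.mp h
  refine eq_zero_of_mul_eq_self_left ht ?_
  rw [Finset.mul_sum]
  exact Fintype.sum_bijective _ (Group.mulLeft_bijective t) _ _ fun s => by simp

/-- A translation preserves the total sum, so the sum of a nontrivial character factors out. -/
theorem sum_charOp (χ : MulChar F ℂ) (h : χ ≠ 1) (f : PuncturedPlane F → ℂ) :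
    ∑ v, charOp χ f v = 0 := by
  simp_rw [charOp_apply]
  rw [Finset.sum_comm]
  have (s : Fˣ) : ∑ v, χ s * f (s • v) = χ s * ∑ v, f v := by
    rw [← Finset.mul_sum]
    congr 1
    exact Equiv.sum_comp (MulAction.toPerm s) f
  rw [Finset.sum_congr rfl fun s _ => this s, ← Finset.sum_mul, sum_mulChar_eq_zero h, zero_mul]

theorem card_units_cast : (Fintype.card Fˣ : ℂ) = (Fintype.card F : ℂ) - 1 := by
  rw [Fintype.card_units, Nat.cast_sub Fintype.card_pos, Nat.cast_one]

theorem card_sub_one_ne_zero : (Fintype.card F : ℂ) - 1 ≠ 0 := by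
  rw [← card_units_cast]
  exact_mod_cast Fintype.card_ne_zero

theorem sum_mulChar_mul_inv (χ χ' : MulChar F ℂ) [DecidableEq (MulChar F ℂ)] :
    ∑ s : Fˣ, χ s * (χ' s)⁻¹ = if χ = χ' then (Fintype.card F : ℂ) - 1 else 0 := by
  have h (s : Fˣ) : χ s * (χ' s)⁻¹ = (χ * χ'⁻¹) s := by
    rw [MulChar.mul_apply, MulChar.inv_apply_eq_inv']
  simp_rw [h]
  split_ifs with hχ
  · subst hχ
    simp [card_units_cast]
  · exact sum_mulChar_eq_zero fun h => hχ (mul_inv_eq_one.mp h)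

theorem sum_mulChar_apply [Fintype (MulChar F ℂ)] (s : Fˣ) :
    ∑ χ : MulChar F ℂ, χ s = if s = 1 then (Fintype.card F : ℂ) - 1 else 0 := by
  have : NeZero ((Monoid.exponent Fˣ : ℕ) : ℂ) :=
    ⟨by exact_mod_cast Monoid.exponent_ne_zero_of_finite⟩
  split_ifs with h
  · subst h
    simp only [Units.val_one, map_one, Finset.sum_const, Finset.card_univ, nsmul_eq_mul, mul_one]
    rw [← card_units_cast, ← Nat.card_eq_fintype_card, ← Nat.card_eq_fintype_card,
      MulChar.card_eq_card_units_of_hasEnoughRootsOfUnity]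
  · have hs : (s : F) ≠ 1 := fun h' => h (Units.ext h')
    obtain ⟨χ, hχ⟩ := MulChar.exists_apply_ne_one_of_hasEnoughRootsOfUnity F ℂ hs
    refine eq_zero_of_mul_eq_self_left hχ ?_
    simp only [Finset.mul_sum, ← MulChar.mul_apply]
    exact Fintype.sum_bijective _ (Group.mulLeft_bijective χ) _ _ fun χ' => rfl

/-- By orthogonality of characters only `s = 1` remains: the operators `charOp χ / (q - 1)` add up
to the identity. -/
theorem sum_charOp_eq [Fintype (MulChar F ℂ)] (f : PuncturedPlane F → ℂ) :
    ∑ χ, charOp χ f = ((Fintype.card F : ℂ) - 1) • f := by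
  ext v
  simp_rw [Finset.sum_apply, charOp_apply]
  rw [Finset.sum_comm]
  simp_rw [← Finset.sum_mul, sum_mulChar_apply]
  simp

/-- Since scalars act freely, only `s = 1` meets the diagonal, so the trace counts the nonzero
vectors. -/
theorem trace_charOp (χ : MulChar F ℂ) :
    LinearMap.trace ℂ _ (charOp χ).toLinearMap = (Fintype.card F : ℂ) ^ 2 - 1 := by
  rw [LinearMap.trace_eq_matrix_trace ℂ (Pi.basisFun ℂ (PuncturedPlane F)), Matrix.trace]
  have h (v : PuncturedPlane F) : Matrix.diag (LinearMap.toMatrix (Pi.basisFun ℂ _)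
      (Pi.basisFun ℂ _) (charOp χ).toLinearMap) v = 1 := by
    rw [Matrix.diag_apply, LinearMap.toMatrix_apply, Pi.basisFun_apply, Pi.basisFun_repr,
      IntertwiningMap.toLinearMap_apply, charOp_apply]
    simp [Pi.single_apply, units_smul_eq_self_iff]
  simp_rw [h]
  rw [Finset.sum_const, Finset.card_univ, card_puncturedPlane, nsmul_eq_mul, mul_one,
    Nat.cast_sub (Nat.one_le_pow _ _ Fintype.card_pos)]
  simp

end PuncturedPlane

end RingWalk

/-! ### The representations `ρ_{χ,1}` inside the functions on nonzero vectors -/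

namespace RingWalk

open Representation PuncturedPlane

variable {F : Type*} [Field F]

theorem apply_base (g : GL (Fin 2) F) (i : Fin 2) : (g • base F).1 i = g i 0 := by
  rw [PuncturedPlane.coe_smul]
  fin_cases i <;> simp [base, Matrix.mulVec, dotProduct]

theorem isUnit_diag_of_mem_borel {g : GL (Fin 2) F} (hg : g ∈ borel F) :
    IsUnit (g 0 0) ∧ IsUnit (g 1 1) := by
  have h10 : g.1 1 0 = 0 := hg
  have := (Matrix.isUnit_iff_isUnit_det g.1).mp g.isUnit
  rw [Matrix.det_fin_two, h10, mul_zero, sub_zero, isUnit_iff_ne_zero, mul_ne_zero_iff] at this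
  exact ⟨isUnit_iff_ne_zero.mpr this.1, isUnit_iff_ne_zero.mpr this.2⟩

theorem borelChar_apply (χ : MulChar F ℂ) (b : borel F) (a : ℂ) :
    borelChar χ 1 b a = χ ((b : GL (Fin 2) F) 0 0) * a := by
  change (χ ((b : GL (Fin 2) F) 0 0) * (1 : MulChar F ℂ) ((b : GL (Fin 2) F) 1 1)) • a = _
  rw [MulChar.one_apply (isUnit_diag_of_mem_borel b.2).2, mul_one, smul_eq_mul]

theorem smul_base_eq_of_mem_borel (b : borel F) :
    (b : GL (Fin 2) F) • base F = (isUnit_diag_of_mem_borel b.2).1.unit • base F := by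
  refine Subtype.ext (funext fun i => ?_)
  rw [apply_base, coe_units_smul]
  have : (b : GL (Fin 2) F) 1 0 = 0 := b.2
  fin_cases i <;> simp [base, this]

theorem borelChar_eq_one_of_smul_base_eq (χ : MulChar F ℂ) (g : GL (Fin 2) F)
    (h : g • base F = base F) : ∃ hg : g ∈ borel F, borelChar χ 1 ⟨g, hg⟩ 1 = 1 := by
  have h0 : g 0 0 = 1 := by rw [← apply_base, h]; rfl
  have h1 : g 1 0 = 0 := by rw [← apply_base, h]; rfl
  refine ⟨h1, ?_⟩
  rw [borelChar_apply]
  simp only [h0, map_one, mul_one]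

theorem exists_mem_borel_smul_base_eq (t : Fˣ) :
    ∃ b : borel F, (b : GL (Fin 2) F) • base F = t • base F := by
  have hdet : (!![(t : F), 0; 0, 1] : Matrix (Fin 2) (Fin 2) F).det ≠ 0 := by simp
  refine ⟨⟨Matrix.GeneralLinearGroup.mkOfDetNeZero _ hdet, rfl⟩, Subtype.ext (funext fun i => ?_)⟩
  rw [apply_base, coe_units_smul]
  fin_cases i <;> simp [base, Matrix.GeneralLinearGroup.mkOfDetNeZero]

theorem one_det_apply (g : GL (Fin 2) F) :
    (1 : MulChar F ℂ) ((g : Matrix (Fin 2) (Fin 2) F).det) = 1 :=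
  MulChar.one_apply ((Matrix.isUnit_iff_isUnit_det g.1).mp g.isUnit)

theorem mem_detConstituent_iff (r) :
    r ∈ (detConstituent (1 : MulChar F ℂ)).toSubmodule ↔ ∀ g, rhoPair 1 1 g r = r := by
  refine forall_congr' fun g => ?_
  rw [one_det_apply, one_smul]

variable [Fintype F]

theorem isCompl_detComplement (μ : MulChar F ℂ) :
    IsCompl (detConstituent μ) (detComplement μ) :=
  Classical.choose_spec (exists_isCompl_detConstituent μ)

variable [DecidableEq F]

/-- The projection of the permutation representation on the nonzero vectors to `ρ_{χ,1}`. -/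
noncomputable def toRhoPair (χ : MulChar F ℂ) : IntertwiningMap (planeRep F) (rhoPair χ 1) :=
  permRepToInd (borelChar χ 1) (base F) (borelChar_eq_one_of_smul_base_eq χ)

/-- The embedding of `ρ_{χ,1}` into the permutation representation on the nonzero vectors. -/
noncomputable def ofRhoPair (χ : MulChar F ℂ) : IntertwiningMap (rhoPair χ 1) (planeRep F) :=
  indLift (borelChar χ 1) (planeRep F)
    (LinearMap.toSpanSingleton ℂ _ (charOp χ (Pi.single (base F) 1))) fun b a => by
      rw [LinearMap.toSpanSingleton_apply, LinearMap.toSpanSingleton_apply, map_smul,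
        ← IntertwiningMap.isIntertwining, permRep_single, smul_base_eq_of_mem_borel,
        charOp_single_smul, smul_smul, borelChar_apply, mul_comm, IsUnit.unit_spec]

theorem toRhoPair_single (χ : MulChar F ℂ) (g : GL (Fin 2) F) :
    toRhoPair χ (Pi.single (g • base F) 1) = indMk (borelChar χ 1) g⁻¹ 1 :=
  permRepToInd_single _ _ _ _

theorem ofRhoPair_indMk (χ : MulChar F ℂ) (g : GL (Fin 2) F) :
    ofRhoPair χ (indMk (borelChar χ 1) g 1) =
      planeRep F g⁻¹ (charOp χ (Pi.single (base F) 1)) := by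
  refine (indLift_mk _ _ _ _ _ _).trans ?_
  rw [LinearMap.toSpanSingleton_apply, one_smul]

theorem toRhoPair_surjective (χ : MulChar F ℂ) : Function.Surjective (toRhoPair χ) :=
  permRepToInd_surjective _ _ _

/-- It suffices to check indicators `g • base F`, where both sides are the `g`-translate of `charOp
χ` at the base point. -/
theorem ofRhoPair_toRhoPair (χ : MulChar F ℂ) (f : PuncturedPlane F → ℂ) :
    ofRhoPair χ (toRhoPair χ f) = charOp χ f := by
  have : (ofRhoPair χ).toLinearMap ∘ₗ (toRhoPair χ).toLinearMap = (charOp χ).toLinearMap := by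
    refine LinearMap.pi_ext' fun x => LinearMap.ext_ring ?_
    obtain ⟨g, rfl⟩ := exists_smul_base_eq x
    change ofRhoPair χ (toRhoPair χ (Pi.single (g • base F) 1)) =
      charOp χ (Pi.single (g • base F) 1)
    rw [toRhoPair_single, ofRhoPair_indMk, inv_inv, ← IntertwiningMap.isIntertwining,
      permRep_single]
  exact LinearMap.congr_fun this f

theorem toRhoPair_single_smul (χ : MulChar F ℂ) (t : Fˣ) (v : PuncturedPlane F) :
    toRhoPair χ (Pi.single (t • v) 1) = χ t • toRhoPair χ (Pi.single v 1) := by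
  obtain ⟨g, rfl⟩ := exists_smul_base_eq v
  obtain ⟨b, hb⟩ := exists_mem_borel_smul_base_eq t
  have h00 : (b : GL (Fin 2) F) 0 0 = t := by
    rw [← apply_base, hb, coe_units_smul]
    simp [base]
  rw [← smul_comm, ← hb, smul_smul, toRhoPair_single, toRhoPair_single,
    ← indMk_mul (borelChar χ 1) b (g * b : GL (Fin 2) F)⁻¹, borelChar_apply, h00,
    _root_.mul_inv_rev, mul_inv_cancel_left, ← map_smul, smul_eq_mul]

theorem toRhoPair_translate (χ : MulChar F ℂ) (t : Fˣ) (f : PuncturedPlane F → ℂ) :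
    toRhoPair χ (fun v => f (t • v)) = (χ t)⁻¹ • toRhoPair χ f := by
  have : (toRhoPair χ).toLinearMap ∘ₗ
      LinearMap.funLeft ℂ ℂ (fun v : PuncturedPlane F => t • v) =
      (χ t)⁻¹ • (toRhoPair χ).toLinearMap := by
    refine LinearMap.pi_ext' fun x => LinearMap.ext_ring ?_
    obtain ⟨y, rfl⟩ := MulAction.surjective t x
    have h : LinearMap.funLeft ℂ ℂ (fun v : PuncturedPlane F => t • v)
        (Pi.single (t • y) 1) = Pi.single y 1 := by
      ext v
      simp [LinearMap.funLeft_apply, Pi.single_apply]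
    change toRhoPair χ (LinearMap.funLeft ℂ ℂ (fun v : PuncturedPlane F => t • v)
        (Pi.single (t • y) 1)) = (χ t)⁻¹ • toRhoPair χ (Pi.single (t • y) 1)
    rw [h, toRhoPair_single_smul, smul_smul, inv_mul_cancel₀, one_smul]
    exact MulChar.apply_ne_zero_iff.mpr t.isUnit
  exact LinearMap.congr_fun this f

theorem toRhoPair_charOp [DecidableEq (MulChar F ℂ)] (χ χ' : MulChar F ℂ)
    (f : PuncturedPlane F → ℂ) : toRhoPair χ (charOp χ' f) =
      (if χ = χ' then (Fintype.card F : ℂ) - 1 else 0) • toRhoPair χ f := by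
  have : charOp χ' f = ∑ s : Fˣ, χ' s • fun v => f (s • v) := by
    ext v
    simp [charOp_apply]
  rw [this, map_sum]
  simp_rw [map_smul, toRhoPair_translate, smul_smul]
  rw [← Finset.sum_smul, sum_mulChar_mul_inv]
  simp only [eq_comm]

/-- Together with the vanishing for distinct characters, this exhibits the `ρ_{χ,1}` as independent
direct summands of the permutation representation. -/
theorem toRhoPair_ofRhoPair_self (χ : MulChar F ℂ) (r) :
    toRhoPair χ (ofRhoPair χ r) = ((Fintype.card F : ℂ) - 1) • r := by
  classical
  obtain ⟨f, rfl⟩ := toRhoPair_surjective χ r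
  rw [ofRhoPair_toRhoPair, toRhoPair_charOp, if_pos rfl]

theorem toRhoPair_ofRhoPair_of_ne {χ χ' : MulChar F ℂ} (h : χ ≠ χ') (r) :
    toRhoPair χ (ofRhoPair χ' r) = 0 := by
  classical
  obtain ⟨f, rfl⟩ := toRhoPair_surjective χ' r
  rw [ofRhoPair_toRhoPair, toRhoPair_charOp, if_neg h, zero_smul]

theorem ofRhoPair_injective (χ : MulChar F ℂ) : Function.Injective (ofRhoPair χ) := by
  intro r s h
  have := congrArg (toRhoPair χ) h
  rw [toRhoPair_ofRhoPair_self, toRhoPair_ofRhoPair_self] at this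
  exact smul_right_injective _ card_sub_one_ne_zero this

instance finiteDimensional_rhoPair (χ : MulChar F ℂ) :
    FiniteDimensional ℂ (IndV (borel F).subtype (borelChar χ 1)) :=
  Module.Finite.of_surjective (toRhoPair χ).toLinearMap (toRhoPair_surjective χ)

/-- The two composites of `toRhoPair χ` and `ofRhoPair χ` have the same trace: one is `q - 1` times
the identity, the other has trace `q² - 1`. -/
theorem finrank_rhoPair (χ : MulChar F ℂ) :
    Module.finrank ℂ (IndV (borel F).subtype (borelChar χ 1)) = Fintype.card F + 1 := by
  have h1 : (ofRhoPair χ).toLinearMap ∘ₗ (toRhoPair χ).toLinearMap = (charOp χ).toLinearMap :=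
    LinearMap.ext (ofRhoPair_toRhoPair χ)
  have h2 : (toRhoPair χ).toLinearMap ∘ₗ (ofRhoPair χ).toLinearMap =
      ((Fintype.card F : ℂ) - 1) • LinearMap.id :=
    LinearMap.ext (toRhoPair_ofRhoPair_self χ)
  have h := trace_charOp χ
  rw [← h1, LinearMap.trace_comp_comm', h2, map_smul, LinearMap.trace_id, smul_eq_mul] at h
  have h3 : (Module.finrank ℂ (IndV (borel F).subtype (borelChar χ 1)) : ℂ) =
      Fintype.card F + 1 := by
    refine mul_left_cancel₀ (card_sub_one_ne_zero (F := F)) (h.trans ?_)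
    ring
  exact_mod_cast h3

theorem ofRhoPair_apply_smul (χ : MulChar F ℂ) (r) (t : Fˣ) (v : PuncturedPlane F) :
    ofRhoPair χ r (t • v) = (χ t)⁻¹ * ofRhoPair χ r v := by
  obtain ⟨f, rfl⟩ := toRhoPair_surjective χ r
  rw [ofRhoPair_toRhoPair, charOp_apply_smul]

theorem sum_ofRhoPair {χ : MulChar F ℂ} (h : χ ≠ 1) (r) : ∑ v, ofRhoPair χ r v = 0 := by
  obtain ⟨f, rfl⟩ := toRhoPair_surjective χ r
  rw [ofRhoPair_toRhoPair, sum_charOp χ h]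

/-- Intertwining maps between the `ρ_{χ,1}`, read in the permutation representation. -/
theorem exists_ofRhoPair_apply_eq {χ χ' : MulChar F ℂ}
    (T : IntertwiningMap (rhoPair χ 1) (rhoPair χ' 1)) :
    ∃ a b : ℂ, ∀ r, ofRhoPair χ' (T r) =
      a • ofRhoPair χ r + fun _ => b * ∑ v, ofRhoPair χ r v := by
  obtain ⟨a, b, h⟩ := exists_permRep_endomorphism_eq
    (((ofRhoPair χ').comp T).comp (toRhoPair χ))
  have hq := card_sub_one_ne_zero (F := F)
  -- Translation by `s` multiplies the image of `ofRhoPair χ` by `χ(s)⁻¹`, so all translations merge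
  -- into one scalar. The factor `(q - 1)⁻¹` undoes `toRhoPair_ofRhoPair_self`.
  refine ⟨((Fintype.card F : ℂ) - 1)⁻¹ * ∑ s, a s * (χ s)⁻¹, ((Fintype.card F : ℂ) - 1)⁻¹ * b,
    fun r => funext fun v => ?_⟩
  have := h (ofRhoPair χ r) v
  rw [IntertwiningMap.comp_apply, IntertwiningMap.comp_apply, toRhoPair_ofRhoPair_self, map_smul,
    map_smul, Pi.smul_apply, smul_eq_mul] at this
  simp_rw [ofRhoPair_apply_smul, ← mul_assoc, ← Finset.sum_mul] at this
  rw [Pi.add_apply, Pi.smul_apply, smul_eq_mul, mul_assoc, mul_assoc, ← mul_add, ← this,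
    inv_mul_cancel_left₀ hq]

instance nontrivial_rhoPair (χ : MulChar F ℂ) :
    Nontrivial (IndV (borel F).subtype (borelChar χ 1)) :=
  Module.nontrivial_of_finrank_pos (R := ℂ) (by rw [finrank_rhoPair]; omega)

theorem isIrreducible_rhoPair {χ : MulChar F ℂ} (h : χ ≠ 1) : (rhoPair χ 1).IsIrreducible := by
  refine IsIrreducible.of_forall_exists_smul fun T => ?_
  obtain ⟨a, b, hT⟩ := exists_ofRhoPair_apply_eq T
  refine ⟨a, fun r => ofRhoPair_injective χ ?_⟩
  rw [hT, sum_ofRhoPair h, map_smul]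
  ext v
  simp

/-- With the sum functional gone, the image of `e r` in the permutation representation is a multiple
of that of `r`. If the characters differed, `toRhoPair χ'` would kill it and force `e r = 0`. -/
theorem eq_of_rhoPair_equiv {χ χ' : MulChar F ℂ} (h : χ ≠ 1)
    (e : (rhoPair χ 1).Equiv (rhoPair χ' 1)) : χ = χ' := by
  by_contra hne
  obtain ⟨a, b, hT⟩ := exists_ofRhoPair_apply_eq e.toIntertwiningMap
  obtain ⟨r, hr⟩ := exists_ne (0 : IndV (borel F).subtype (borelChar χ' 1))
  obtain ⟨r, rfl⟩ := e.toLinearEquiv.surjective r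
  have h1 := congrArg (toRhoPair χ') (hT r)
  have h2 : (fun _ => b * ∑ v, ofRhoPair χ r v : PuncturedPlane F → ℂ) = 0 := by
    rw [sum_ofRhoPair h, mul_zero]
    rfl
  rw [h2, add_zero, toRhoPair_ofRhoPair_self, map_smul, toRhoPair_ofRhoPair_of_ne (Ne.symm hne),
    smul_zero, smul_eq_zero] at h1
  exact h1.elim card_sub_one_ne_zero hr

/-! ### The constituents of `ρ_{1,1}` -/

/-- The image of the constant function `1` in `ρ_{1,1}`. -/
noncomputable def rhoPairInvariant (F : Type*) [Field F] [Fintype F] [DecidableEq F] :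
    IndV (borel F).subtype (borelChar (1 : MulChar F ℂ) 1) :=
  toRhoPair 1 fun _ => 1

theorem ofRhoPair_rhoPairInvariant :
    ofRhoPair 1 (rhoPairInvariant F) = fun _ => (Fintype.card F : ℂ) - 1 := by
  ext v
  rw [rhoPairInvariant, ofRhoPair_toRhoPair, charOp_apply]
  simp [card_units_cast]

theorem rhoPairInvariant_ne_zero : rhoPairInvariant F ≠ 0 := by
  intro h
  have := ofRhoPair_rhoPairInvariant (F := F)
  rw [h, map_zero] at this
  exact card_sub_one_ne_zero (congrFun this (base F)).symm

/-- An invariant vector becomes an invariant function on a transitive set, that is, a constant. -/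
theorem detConstituent_eq_span : (detConstituent (1 : MulChar F ℂ)).toSubmodule =
    Submodule.span ℂ {rhoPairInvariant F} := by
  ext r
  rw [Submodule.mem_span_singleton, mem_detConstituent_iff]
  constructor
  · intro h
    refine ⟨((Fintype.card F : ℂ) - 1)⁻¹ * ofRhoPair 1 r (base F), ofRhoPair_injective 1 ?_⟩
    rw [map_smul, ofRhoPair_rhoPairInvariant]
    ext v
    obtain ⟨g, rfl⟩ := exists_smul_base_eq v
    have h1 : ofRhoPair 1 r (g • base F) = ofRhoPair 1 r (base F) := by
      conv_lhs => rw [← h g, IntertwiningMap.isIntertwining, permRep_apply, inv_smul_smul]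
    rw [h1, Pi.smul_apply, smul_eq_mul, mul_comm, mul_inv_cancel_left₀ card_sub_one_ne_zero]
  · rintro ⟨a, rfl⟩ g
    rw [map_smul, rhoPairInvariant, ← IntertwiningMap.isIntertwining]
    rfl

theorem finrank_detConstituent :
    Module.finrank ℂ (detConstituent (1 : MulChar F ℂ)).toSubmodule = 1 := by
  rw [detConstituent_eq_span]
  exact finrank_span_singleton rhoPairInvariant_ne_zero

theorem finrank_detComplement :
    Module.finrank ℂ (detComplement (1 : MulChar F ℂ)).toSubmodule = Fintype.card F := by
  have := Submodule.finrank_add_eq_of_isCompl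
    (Subrepresentation.isCompl_toSubmodule (isCompl_detComplement (1 : MulChar F ℂ)))
  rw [finrank_detConstituent, finrank_rhoPair, add_comm] at this
  exact Nat.add_right_cancel this

theorem isIrreducible_rhoCompl : (rhoCompl (1 : MulChar F ℂ)).IsIrreducible := by
  have : Nontrivial (detComplement (1 : MulChar F ℂ)).toSubmodule :=
    Module.nontrivial_of_finrank_pos (R := ℂ) (by
      rw [finrank_detComplement]
      exact Fintype.card_pos)
  have hc := isCompl_detComplement (1 : MulChar F ℂ)
  refine IsIrreducible.of_forall_exists_smul
    (ρ := (detComplement (1 : MulChar F ℂ)).toRepresentation) fun T => ?_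
  obtain ⟨a, b, hT⟩ := exists_ofRhoPair_apply_eq
    ((((detComplement (1 : MulChar F ℂ)).inclusion).comp T).comp
      (Subrepresentation.projection hc.symm))
  refine ⟨a, fun w => ?_⟩
  have hw := hT w
  rw [IntertwiningMap.comp_apply, IntertwiningMap.comp_apply,
    Subrepresentation.projection_of_mem hc.symm w.2, Subrepresentation.inclusion_apply] at hw
  -- For `χ = 1` the sum functional survives but only adds a constant function, which belongs to the
  -- invariant line. So `T w - a • w` lies both in that line and in its complement.
  have h1 : ((T w - a • w : (detComplement (1 : MulChar F ℂ)).toSubmodule) :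
      IndV (borel F).subtype (borelChar (1 : MulChar F ℂ) 1)) ∈
      (detConstituent (1 : MulChar F ℂ)).toSubmodule := by
    rw [detConstituent_eq_span, Submodule.mem_span_singleton]
    refine ⟨((Fintype.card F : ℂ) - 1)⁻¹ * (b * ∑ v, ofRhoPair 1 w.1 v),
      ofRhoPair_injective 1 ?_⟩
    rw [map_smul, ofRhoPair_rhoPairInvariant, Submodule.coe_sub, Submodule.coe_smul, map_sub,
      map_smul, hw, add_sub_cancel_left]
    ext v
    rw [Pi.smul_apply, smul_eq_mul, mul_comm, mul_inv_cancel_left₀ card_sub_one_ne_zero]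
  have h2 := Submodule.disjoint_def.mp (Subrepresentation.isCompl_toSubmodule hc).disjoint _ h1
    (Submodule.coe_mem _)
  exact sub_eq_zero.mp (Subtype.ext h2)

end RingWalk

/-! ### Factorisation of rank-one matrices and the set `Σ_A` -/

namespace RingWalk

open Representation PuncturedPlane

variable {F : Type*} [Field F]

theorem exists_eq_vecMulVec_of_det_eq_zero {A : Matrix (Fin 2) (Fin 2) F} (h0 : A ≠ 0)
    (hA : A.det = 0) : ∃ v w : PuncturedPlane F, A = Matrix.vecMulVec v.1 w.1 := by
  obtain ⟨u, hu, hAu⟩ := Matrix.exists_mulVec_eq_zero_iff.mpr hA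
  -- Every row of `A` is orthogonal to the kernel vector `u`, hence a multiple of `(u₁, -u₀)`.
  have hw : (![u 1, - u 0] : Fin 2 → F) ≠ 0 := by
    intro h
    refine hu (funext fun i => ?_)
    have h1 := congrFun h 0
    have h2 := congrFun h 1
    simp only [Matrix.cons_val_zero, Matrix.cons_val_one, Pi.zero_apply, neg_eq_zero] at h1 h2
    fin_cases i
    · exact h2
    · exact h1
  have hrow (i : Fin 2) : A i 0 * u 0 + A i 1 * u 1 = 0 := by
    have := congrFun hAu i
    simpa [Matrix.mulVec, dotProduct, Fin.sum_univ_two] using this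
  suffices ∃ v : Fin 2 → F, A = Matrix.vecMulVec v ![u 1, - u 0] by
    obtain ⟨v, hv⟩ := this
    refine ⟨⟨v, ?_⟩, ⟨_, hw⟩, hv⟩
    rintro rfl
    exact h0 (hv.trans (Matrix.zero_vecMulVec _))
  by_cases h : u 1 = 0
  · have hu0 : u 0 ≠ 0 := fun h' => hu (funext fun i => by fin_cases i <;> simp [h, h'])
    refine ⟨fun i => - A i 1 / u 0, ?_⟩
    ext i j
    have := hrow i
    rw [h, mul_zero, add_zero, mul_eq_zero, or_iff_left hu0] at this
    fin_cases j
    · simp [Matrix.vecMulVec_apply, h, this]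
    · simp [Matrix.vecMulVec_apply]
      field_simp
  · refine ⟨fun i => A i 0 / u 1, ?_⟩
    ext i j
    fin_cases j
    · simp [Matrix.vecMulVec_apply, h]
    · simp only [Matrix.vecMulVec_apply, Fin.mk_one, Matrix.cons_val_one, Matrix.cons_val_fin_one]
      field_simp
      linear_combination hrow i

theorem vecMulVec_left_injective {w : Fin 2 → F} (hw : w ≠ 0) {v v' : Fin 2 → F}
    (h : Matrix.vecMulVec v w = Matrix.vecMulVec v' w) : v = v' := by
  obtain ⟨j, hj⟩ := Function.ne_iff.mp hw
  funext i
  have := congrFun (congrFun h i) j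
  rw [Matrix.vecMulVec_apply, Matrix.vecMulVec_apply] at this
  exact mul_right_cancel₀ hj this

theorem units_smul_vecMulVec_eq_iff (g : GL (Fin 2) F) (v w : PuncturedPlane F) :
    g • Matrix.vecMulVec v.1 w.1 = Matrix.vecMulVec v.1 w.1 ↔ g • v = v := by
  have : g • Matrix.vecMulVec v.1 w.1 = Matrix.vecMulVec (g • v).1 w.1 :=
    Matrix.mul_vecMulVec _ _ _
  rw [this]
  refine ⟨fun h => Subtype.ext (vecMulVec_left_injective w.2 h), fun h => by rw [h]⟩

variable [Fintype F]

theorem isIrreducible_trivGL : (trivGL F).IsIrreducible :=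
  IsIrreducible.of_forall_exists_smul (ρ := trivGL F) fun T => ⟨T 1, fun v => by
    have := map_smul T v 1
    simpa [mul_comm] using this⟩

variable [DecidableEq F]

/-- A nonzero intertwining map into `Ind_{LStab(A)}(1)` exists if and only if there is one into
the permutation representation on the nonzero vectors. -/
theorem mem_constituents_iff {A : Matrix (Fin 2) (Fin 2) F} (hA : A.rank = 1)
    (c : Irr (GL (Fin 2) F)) :
    c ∈ constituents A ↔ ∃ f : c.rep.IntertwiningMap (planeRep F), f ≠ 0 := by
  have h0 : A ≠ 0 := by
    rintro rfl
    simp at hA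
  have hdet : A.det = 0 := by
    by_contra h
    have := Matrix.rank_of_isUnit A ((Matrix.isUnit_iff_isUnit_det A).mpr (isUnit_iff_ne_zero.mpr h))
    rw [hA] at this
    simp at this
  obtain ⟨v, w, rfl⟩ := exists_eq_vecMulVec_of_det_eq_zero h0 hdet
  set A := Matrix.vecMulVec v.1 w.1
  let H := MulAction.stabilizer (GL (Fin 2) F) A
  let σ := Representation.trivial ℂ H ℂ
  have hH (g : GL (Fin 2) F) : g ∈ H ↔ g • v = v := units_smul_vecMulVec_eq_iff g v w
  -- `LStab(A)` is the stabilizer of the column `v`, so the induced representation is that of the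
  -- functions on the orbit of `v`. `Φ` and `Ψ` are the two directions of this identification.
  let Φ := permRepToInd (H := H) σ v fun g hg => ⟨(hH g).mpr hg, rfl⟩
  let Ψ := indLift (H := H) σ (planeRep F) (LinearMap.toSpanSingleton ℂ _ (Pi.single v 1))
    fun b a => by
      rw [LinearMap.toSpanSingleton_apply, LinearMap.toSpanSingleton_apply, map_smul,
        permRep_single, (hH b).mp b.2]
      rfl
  have hΨΦ (f) : Ψ (Φ f) = f := by
    have : Ψ.toLinearMap ∘ₗ Φ.toLinearMap = LinearMap.id := by
      refine LinearMap.pi_ext' fun x => LinearMap.ext_ring ?_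
      obtain ⟨g, rfl⟩ := MulAction.exists_smul_eq (GL (Fin 2) F) v x
      change Ψ (Φ (Pi.single (g • v) 1)) = Pi.single (g • v) 1
      rw [permRepToInd_single, indLift_mk, LinearMap.toSpanSingleton_apply, one_smul, inv_inv,
        permRep_single]
    exact LinearMap.congr_fun this f
  have hΦ : Function.Surjective Φ := permRepToInd_surjective _ _ _
  constructor
  · rintro ⟨f, hf⟩
    refine ⟨Ψ.comp f, fun h => hf (IntertwiningMap.ext (LinearMap.ext fun x => ?_))⟩
    obtain ⟨y, hy⟩ := hΦ (f x)
    have hx : Ψ (f x) = 0 := congrArg (fun T : c.rep.IntertwiningMap (planeRep F) => T x) h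
    rw [← hy, hΨΦ] at hx
    change f x = 0
    rw [← hy, hx, map_zero]
  · rintro ⟨f, hf⟩
    refine ⟨Φ.comp f, fun h => hf (IntertwiningMap.ext (LinearMap.ext fun x => ?_))⟩
    have hx : Φ (f x) = 0 := congrArg (fun T : c.rep.IntertwiningMap (indLStab A) => T x) h
    have := hΨΦ (f x)
    rw [hx, map_zero] at this
    exact this.symm

/-- The permutation representation on the nonzero vectors is the sum of the `ρ_{χ,1}`. -/
noncomputable def planeEquiv (F : Type*) [Field F] [Fintype F] [DecidableEq F] :
    (PuncturedPlane F → ℂ) ≃ₗ[ℂ]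
      ∀ χ : MulChar F ℂ, IndV (borel F).subtype (borelChar χ 1) := by
  classical
  exact
  have := Fintype.ofFinite (MulChar F ℂ)
  { toFun := fun f χ => toRhoPair χ f
    map_add' := fun f g => funext fun χ => map_add _ _ _
    map_smul' := fun a f => funext fun χ => map_smul _ _ _
    invFun := fun r => ((Fintype.card F : ℂ) - 1)⁻¹ • ∑ χ, ofRhoPair χ (r χ)
    left_inv := fun f => by
      simp only [ofRhoPair_toRhoPair, sum_charOp_eq, smul_smul]
      rw [inv_mul_cancel₀ card_sub_one_ne_zero, one_smul]
    right_inv := fun r => by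
      funext χ
      simp only
      rw [map_smul, map_sum, Finset.sum_eq_single χ, toRhoPair_ofRhoPair_self, smul_smul,
        inv_mul_cancel₀ card_sub_one_ne_zero, one_smul]
      · intro χ' _ h
        rw [toRhoPair_ofRhoPair_of_ne h.symm]
      · simp }

/-- The subrepresentation of invariants of `ρ_{1,1}` is the trivial representation. -/
noncomputable def trivEquivDetConstituent (F : Type*) [Field F] [Fintype F] [DecidableEq F] :
    (trivGL F).Equiv (detConstituent (1 : MulChar F ℂ)).toRepresentation :=
  let u : (detConstituent (1 : MulChar F ℂ)).toSubmodule :=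
    ⟨rhoPairInvariant F, detConstituent_eq_span (F := F) ▸ Submodule.mem_span_singleton_self _⟩
  IntertwiningMap.ofBijective
    (⟨LinearMap.toSpanSingleton ℂ _ u, fun g => LinearMap.ext_ring (Subtype.ext (by
      simp only [LinearMap.comp_apply, LinearMap.toSpanSingleton_apply_one]
      exact (((mem_detConstituent_iff _).mp u.2 g).trans
        (congrArg Subtype.val (one_smul ℂ u)).symm).symm))⟩ :
      IntertwiningMap (trivGL F) (detConstituent (1 : MulChar F ℂ)).toRepresentation) (by
    constructor
    · intro a b h
      have h' : a • rhoPairInvariant F = b • rhoPairInvariant F := congrArg Subtype.val h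
      exact smul_left_injective ℂ rhoPairInvariant_ne_zero h'
    · rintro ⟨x, hx⟩
      have hx' := hx
      rw [detConstituent_eq_span, Submodule.mem_span_singleton] at hx'
      obtain ⟨a, ha⟩ := hx'
      exact ⟨a, Subtype.ext ha⟩)

theorem exists_ne_zero_of_equiv {G U V W : Type*} [Group G] [AddCommGroup U] [Module ℂ U]
    [AddCommGroup V] [Module ℂ V] [AddCommGroup W] [Module ℂ W] {ρ : Representation ℂ G U}
    {σ : Representation ℂ G V} {τ : Representation ℂ G W} (e : ρ.Equiv σ)
    (T : σ.IntertwiningMap τ) (v : V) (hv : T v ≠ 0) : ∃ f : ρ.IntertwiningMap τ, f ≠ 0 := by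
  refine ⟨T.comp e.toIntertwiningMap, fun h => hv ?_⟩
  obtain ⟨x, rfl⟩ := e.toLinearEquiv.surjective v
  exact congrArg (fun T : ρ.IntertwiningMap τ => T x) h

/-- A nonzero map into the permutation representation has a nonzero component in some `ρ_{χ,1}`.
Schur's lemma turns such a component, projected to an irreducible summand if `χ = 1`, into an
isomorphism. -/
theorem constituents_eq {A : Matrix (Fin 2) (Fin 2) F} (hA : A.rank = 1) :
    constituents A = {c : Irr (GL (Fin 2) F) |
        Nonempty (c.rep.Equiv (trivGL F)) ∨
        Nonempty (c.rep.Equiv (rhoCompl (1 : MulChar F ℂ))) ∨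
        ∃ χ : MulChar F ℂ, χ ≠ 1 ∧ Nonempty (c.rep.Equiv (rhoPair χ 1))} := by
  ext c
  rw [mem_constituents_iff hA, Set.mem_ofPred_eq]
  have hc := isCompl_detComplement (1 : MulChar F ℂ)
  constructor
  · rintro ⟨f, hf⟩
    have key : ∃ χ : MulChar F ℂ, (toRhoPair χ).comp f ≠ 0 := by
      by_contra! h
      refine hf (IntertwiningMap.ext (LinearMap.ext fun x => (planeEquiv F).injective ?_))
      funext χ
      change toRhoPair χ (f x) = toRhoPair χ 0
      rw [map_zero]
      exact congrArg (fun T : c.rep.IntertwiningMap (rhoPair χ 1) => T x) (h χ)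
    obtain ⟨χ, hχ⟩ := key
    by_cases h1 : χ = 1
    · subst h1
      by_cases h2 : (Subrepresentation.projection hc.symm).comp ((toRhoPair 1).comp f) = 0
      · left
        -- With zero component in the complement, the component in the invariant line cannot vanish
        -- as well.
        have h4 : ((trivEquivDetConstituent F).symm.toIntertwiningMap.comp
            (Subrepresentation.projection hc)).comp ((toRhoPair 1).comp f) ≠ 0 := by
          refine fun h => hχ (IntertwiningMap.ext (LinearMap.ext fun x => ?_))
          have h5 : Subrepresentation.projection hc.symm (toRhoPair 1 (f x)) = 0 :=
            congrArg (fun T : c.rep.IntertwiningMap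
              (detComplement (1 : MulChar F ℂ)).toRepresentation => T x) h2
          have h6 : (trivEquivDetConstituent F).symm
              (Subrepresentation.projection hc (toRhoPair 1 (f x))) = 0 :=
            congrArg (fun T : c.rep.IntertwiningMap (trivGL F) => T x) h
          rw [EmbeddingLike.map_eq_zero_iff, Subrepresentation.projection_eq_zero_iff] at h6
          rw [Subrepresentation.projection_eq_zero_iff] at h5
          exact Submodule.disjoint_def.mp
            (Subrepresentation.isCompl_toSubmodule hc).disjoint _ h5 h6
        have := isIrreducible_trivGL (F := F)
        exact ⟨IntertwiningMap.ofBijective _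
          ((IsIrreducible.bijective_or_eq_zero _).resolve_right h4)⟩
      · right; left
        have := isIrreducible_rhoCompl (F := F)
        have h3 := (IsIrreducible.bijective_or_eq_zero
          (σ := rhoCompl (1 : MulChar F ℂ)) _).resolve_right h2
        exact ⟨IntertwiningMap.ofBijective _ h3⟩
    · right; right
      have := isIrreducible_rhoPair h1
      exact ⟨χ, h1, ⟨IntertwiningMap.ofBijective _
        ((IsIrreducible.bijective_or_eq_zero _).resolve_right hχ)⟩⟩
  · rintro (⟨⟨e⟩⟩ | ⟨⟨e⟩⟩ | ⟨χ, -, ⟨e⟩⟩)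
    · refine exists_ne_zero_of_equiv e ((ofRhoPair 1).comp
        ((detConstituent (1 : MulChar F ℂ)).inclusion.comp
        (trivEquivDetConstituent F).toIntertwiningMap)) 1 fun h => ?_
      have h1 := ofRhoPair_injective 1 (h.trans (map_zero (ofRhoPair 1)).symm)
      have h2 : trivEquivDetConstituent F 1 = 0 := Subtype.ext h1
      rw [EmbeddingLike.map_eq_zero_iff] at h2
      exact one_ne_zero h2
    · have : Nontrivial (detComplement (1 : MulChar F ℂ)).toSubmodule :=
        Module.nontrivial_of_finrank_pos (R := ℂ) (by
          rw [finrank_detComplement]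
          exact Fintype.card_pos)
      obtain ⟨r, hr⟩ := exists_ne (0 : (detComplement (1 : MulChar F ℂ)).toSubmodule)
      refine exists_ne_zero_of_equiv (σ := (detComplement (1 : MulChar F ℂ)).toRepresentation) e
        ((ofRhoPair 1).comp (detComplement (1 : MulChar F ℂ)).inclusion) r fun h => hr ?_
      exact Subtype.ext (ofRhoPair_injective 1 (h.trans (map_zero (ofRhoPair 1)).symm))
    · obtain ⟨r, hr⟩ := exists_ne (0 : IndV (borel F).subtype (borelChar χ 1))
      refine exists_ne_zero_of_equiv e (ofRhoPair χ) r fun h =>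
        hr (ofRhoPair_injective χ (h.trans (map_zero _).symm))

theorem _root_.Subrepresentation.charpoly_sum_smul {G V : Type*} [Group G] [Fintype G]
    [AddCommGroup V] [Module ℂ V] [FiniteDimensional ℂ V] {ρ : Representation ℂ G V}
    {N N' : Subrepresentation ρ} (h : IsCompl N N') (f : G → ℂ) :
    (∑ g, f g • ρ g).charpoly = (∑ g, f g • N.toRepresentation g).charpoly *
      (∑ g, f g • N'.toRepresentation g).charpoly := by
  rw [← LinearMap.charpoly_prodMap, ← LinearEquiv.charpoly_conj
    (Submodule.prodEquivOfIsCompl _ _ (Subrepresentation.isCompl_toSubmodule h))]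
  congr 1
  refine LinearMap.ext fun v => ?_
  obtain ⟨w, rfl⟩ := (Submodule.prodEquivOfIsCompl _ _
    (Subrepresentation.isCompl_toSubmodule h)).surjective v
  rw [LinearEquiv.conj_apply_apply, LinearEquiv.symm_apply_apply]
  simp only [LinearMap.sum_apply, LinearMap.smul_apply, Submodule.coe_prodEquivOfIsCompl',
    LinearMap.prodMap_apply, map_add, Submodule.coe_sum,
    Submodule.coe_smul]
  rfl

theorem charpoly_sum_eq_of_equiv {G V W : Type*} [Group G] [Fintype G]
    [AddCommGroup V] [Module ℂ V] [FiniteDimensional ℂ V] [AddCommGroup W] [Module ℂ W]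
    [FiniteDimensional ℂ W] {ρ : Representation ℂ G V} {σ : Representation ℂ G W}
    (e : ρ.Equiv σ) (f : G → ℂ) :
    (∑ g, f g • ρ g).charpoly = (∑ g, f g • σ g).charpoly := by
  rw [← LinearEquiv.charpoly_conj e.toLinearEquiv]
  congr 1
  refine LinearMap.ext fun v => ?_
  obtain ⟨w, rfl⟩ := e.toLinearEquiv.surjective v
  rw [LinearEquiv.conj_apply_apply, LinearEquiv.symm_apply_apply]
  simp only [LinearMap.sum_apply, LinearMap.smul_apply, map_sum, map_smul]
  exact Finset.sum_congr rfl fun g _ => congrArg _ (e.toIntertwiningMap.isIntertwining _ _ g w)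

theorem charpoly_sum_of_isIrreducible {G V : Type*} [Group G] [Fintype G]
    [AddCommGroup V] [Module ℂ V] [FiniteDimensional ℂ V] {ρ : Representation ℂ G V}
    (h : ρ.IsIrreducible) (f : G → ℂ) (hf : ∀ g h, f (h * g * h⁻¹) = f g) :
    (∑ g, f g • ρ g).charpoly =
      (X - C ((∑ g, f g * ρ.character g) / Module.finrank ℂ V)) ^ Module.finrank ℂ V := by
  rw [sum_smul_eq_smul_id_of_isIrreducible ρ f hf, LinearMap.charpoly_smul_id]

/-- The spectrum of a class function on the permutation representation on the nonzero vectors. -/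
theorem charpoly_sum_planeRep (f : GL (Fin 2) F → ℂ) (hf : ∀ g h, f (h * g * h⁻¹) = f g) :
    (∑ g, f g • planeRep F g).charpoly =
      (X - C ((∑ g, f g * (trivGL F).character g) / Module.finrank ℂ ℂ)) ^ 1 *
      (X - C ((∑ g, f g * (rhoCompl (1 : MulChar F ℂ)).character g) /
        Module.finrank ℂ (detComplement (1 : MulChar F ℂ)).toSubmodule)) ^ Fintype.card F *
      ∏ᶠ (χ : MulChar F ℂ) (_ : χ ≠ 1),
        (X - C ((∑ g, f g * (rhoPair χ 1).character g) /
          Module.finrank ℂ (IndV (borel F).subtype (borelChar χ (1 : MulChar F ℂ))))) ^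
            (Fintype.card F + 1) := by
  classical
  have := Fintype.ofFinite (MulChar F ℂ)
  rw [LinearMap.charpoly_eq_prod_of_equiv_pi (planeEquiv F) _
    (fun χ => ∑ g, f g • rhoPair χ 1 g), ← Finset.mul_prod_erase _ _ (Finset.mem_univ 1),
    Subrepresentation.charpoly_sum_smul (isCompl_detComplement (1 : MulChar F ℂ)),
    ← charpoly_sum_eq_of_equiv (trivEquivDetConstituent F),
    charpoly_sum_of_isIrreducible isIrreducible_trivGL f hf]
  · congr 1
    · congr 1
      · rw [Module.finrank_self]
      · refine (charpoly_sum_of_isIrreducible isIrreducible_rhoCompl f hf).trans ?_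
        rw [finrank_detComplement]
    · rw [finprod_cond_eq_prod_of_cond_iff (t := Finset.univ.erase 1) _ (by simp)]
      refine Finset.prod_congr rfl fun χ hχ => ?_
      rw [charpoly_sum_of_isIrreducible (isIrreducible_rhoPair (Finset.ne_of_mem_erase hχ)) f hf]
      congr 1
      exact finrank_rhoPair χ
  · intro f χ
    simp only [LinearMap.sum_apply, LinearMap.smul_apply, map_sum, map_smul, Finset.sum_apply,
      Pi.smul_apply]
    exact Finset.sum_congr rfl fun g _ => congrArg _ ((toRhoPair χ).isIntertwining _ _ g f)

end RingWalk

namespace RingWalk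

open Representation PuncturedPlane

/-! ### Sums over similarity classes -/

section SimilarityClasses

variable {R : Type*} [Ring R]

theorem mem_simClass_symm {r s : R} (h : s ∈ simClass r) : r ∈ simClass s := by
  obtain ⟨u, rfl⟩ := h
  exact ⟨u⁻¹, by simp [mul_assoc]⟩

theorem mem_simClass_trans {r s t : R} (h : s ∈ simClass r) (h' : t ∈ simClass s) :
    t ∈ simClass r := by
  obtain ⟨u, rfl⟩ := h
  obtain ⟨w, rfl⟩ := h'
  exact ⟨w * u, by simp [mul_assoc]⟩

/-- Sending each element to its representative partitions `R` with fibres the similarity classes, on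
which `f` is constant. -/
theorem sum_transversal_mul_ncard [Fintype R] {ψ : Finset R}
    (hψ : IsSimilarityTransversal ψ) (f : R → ℂ) (hf : ∀ r, ∀ s ∈ simClass r, f s = f r) :
    ∑ x ∈ ψ, f x * ((simClass x).ncard : ℂ) = ∑ x, f x := by
  classical
  choose p hp hp' using hψ
  rw [← Finset.sum_fiberwise_of_maps_to (s := Finset.univ) (t := ψ) (g := p) (fun x _ => (hp x).1)]
  refine Finset.sum_congr rfl fun y hy => ?_
  have hfib (x : R) : p x = y ↔ x ∈ simClass y := by
    constructor
    · rintro rfl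
      exact mem_simClass_symm (hp x).2
    · intro hx
      exact (hp' x y ⟨hy, mem_simClass_symm hx⟩).symm
  rw [Finset.sum_congr rfl (g := fun _ => f y), Finset.sum_const, nsmul_eq_mul, mul_comm]
  · congr 2
    rw [← Set.ncard_coe_finset]
    congr 1
    ext x
    simp [hfib]
  · intro x hx
    exact hf y x ((hfib x).mp (Finset.mem_filter.mp hx).2)

end SimilarityClasses

/-! ### Similarity and counting of `2 × 2` matrices by trace and determinant -/

variable {F : Type*} [Field F]

/-- The companion matrix of `X² - τ X + δ`. -/
def companion (τ δ : F) : Matrix (Fin 2) (Fin 2) F := !![0, -δ; 1, τ]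

/-- A nonscalar matrix has a cyclic vector `v`; in the basis `v, x v` it becomes its companion
matrix by Cayley–Hamilton. -/
theorem mem_simClass_companion {x : Matrix (Fin 2) (Fin 2) F} (hx : ∀ a : F, x ≠ a • 1) :
    x ∈ simClass (companion x.trace x.det) := by
  -- This is the determinant with columns `v` and `x v`. If it vanishes at `e₁`, `e₂` and `e₁ + e₂`,
  -- then `x` is scalar.
  obtain ⟨v, hv⟩ : ∃ v : Fin 2 → F, v 0 * (x *ᵥ v) 1 - (x *ᵥ v) 0 * v 1 ≠ 0 := by
    by_contra! h
    have h1 := h ![1, 0]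
    have h2 := h ![0, 1]
    have h3 := h ![1, 1]
    simp [Matrix.mulVec, dotProduct, Fin.sum_univ_two] at h1 h2 h3
    refine hx (x 0 0) ?_
    ext i j
    fin_cases i <;> fin_cases j <;> simp [h1, h2]
    rw [h1, h2] at h3
    linear_combination h3
  let g : GL (Fin 2) F := Matrix.GeneralLinearGroup.mkOfDetNeZero
    !![v 0, (x *ᵥ v) 0; v 1, (x *ᵥ v) 1] (by rw [Matrix.det_fin_two_of]; exact hv)
  refine ⟨g, ?_⟩
  rw [Units.eq_mul_inv_iff_mul_eq]
  change x * !![v 0, (x *ᵥ v) 0; v 1, (x *ᵥ v) 1] = !![v 0, (x *ᵥ v) 0; v 1, (x *ᵥ v) 1] * _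
  ext i j
  fin_cases i <;> fin_cases j <;>
    simp [companion, Matrix.mul_apply, Matrix.mulVec, dotProduct, Fin.sum_univ_two,
      Matrix.trace_fin_two, Matrix.det_fin_two] <;> ring

theorem mem_simClass_of_trace_eq_of_det_eq {x y : Matrix (Fin 2) (Fin 2) F}
    (hx : ∀ a : F, x ≠ a • 1) (hy : ∀ a : F, y ≠ a • 1) (ht : x.trace = y.trace)
    (hd : x.det = y.det) : y ∈ simClass x :=
  mem_simClass_trans (mem_simClass_symm (mem_simClass_companion hx))
    (ht ▸ hd ▸ mem_simClass_companion hy)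

theorem ne_smul_one_of_apply {x : Matrix (Fin 2) (Fin 2) F}
    (h : x 0 1 ≠ 0 ∨ x 1 0 ≠ 0 ∨ x 0 0 ≠ x 1 1) (a : F) : x ≠ a • 1 := by
  rintro rfl
  simp at h

theorem Y₀_mem_simClass {x : Matrix (Fin 2) (Fin 2) F} (h0 : x ≠ 0) (hd : x.det = 0)
    (ht : x.trace = 0) : x ∈ simClass Y₀ := by
  refine mem_simClass_of_trace_eq_of_det_eq (ne_smul_one_of_apply (by simp [Y₀])) ?_
    (by simp [Y₀, ht, Matrix.trace_fin_two]) (by simp [Y₀, hd])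
  rintro a rfl
  simp only [Matrix.det_smul, Fintype.card_fin, Matrix.det_one, mul_one] at hd
  exact h0 (by rw [pow_eq_zero_iff two_ne_zero |>.mp hd, zero_smul])

theorem Y_mem_simClass {x : Matrix (Fin 2) (Fin 2) F} (hd : x.det = 0) (t : Fˣ)
    (ht : x.trace = t) : x ∈ simClass (Y t) := by
  refine mem_simClass_of_trace_eq_of_det_eq (ne_smul_one_of_apply (by simp [Y])) ?_
    (by simp [Y, ht, Matrix.trace_fin_two]) (by simp [Y, hd])
  rintro a rfl
  simp only [Matrix.det_smul, Fintype.card_fin, Matrix.det_one, mul_one] at hd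
  rw [pow_eq_zero_iff two_ne_zero |>.mp hd, zero_smul, Matrix.trace_zero] at ht
  exact t.ne_zero ht.symm

theorem trace_eq_of_mem_simClass {x y : Matrix (Fin 2) (Fin 2) F} (h : y ∈ simClass x) :
    y.trace = x.trace := by
  obtain ⟨u, rfl⟩ := h
  rw [Matrix.trace_mul_comm, ← mul_assoc, Units.inv_mul, one_mul]

theorem det_eq_of_mem_simClass {x y : Matrix (Fin 2) (Fin 2) F} (h : y ∈ simClass x) :
    y.det = x.det := by
  obtain ⟨u, rfl⟩ := h
  rw [Matrix.det_mul, Matrix.det_mul, mul_right_comm, ← Matrix.det_mul, Units.mul_inv,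
    Matrix.det_one, one_mul]

theorem eq_one_iff_of_mem_simClass {x y : Matrix (Fin 2) (Fin 2) F} (h : y ∈ simClass x) :
    y = 1 ↔ x = 1 := by
  obtain ⟨u, rfl⟩ := h
  constructor
  · intro h
    rw [Units.mul_inv_eq_iff_eq_mul, one_mul] at h
    rw [← Units.inv_mul_cancel_left u x, h, Units.inv_mul]
  · rintro rfl
    simp

/-- A `2 × 2` matrix is given by its first column and its second column. -/
def matrixEquivColumns (F : Type*) : Matrix (Fin 2) (Fin 2) F ≃ (F × F) × (F × F) where
  toFun x := ((x 0 0, x 1 0), (x 0 1, x 1 1))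
  invFun p := !![p.1.1, p.2.1; p.1.2, p.2.2]
  left_inv x := by ext i j; fin_cases i <;> fin_cases j <;> rfl
  right_inv p := rfl

theorem matrixEquivColumns_symm_apply {K : Type*} (p : (K × K) × (K × K)) :
    (matrixEquivColumns K).symm p = !![p.1.1, p.2.1; p.1.2, p.2.2] := rfl

variable [Fintype F] [DecidableEq F]

theorem sum_mulVec_base (f : Matrix (Fin 2) (Fin 2) F → ℂ) (w : Fin 2 → F) :
    ∑ x with x *ᵥ ![1, 0] = w, f x = ∑ b, ∑ d, f !![w 0, b; w 1, d] := by
  rw [Finset.sum_filter, ← Equiv.sum_comp (matrixEquivColumns F).symm, Fintype.sum_prod_type,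
    Finset.sum_eq_single (w 0, w 1), ← Fintype.sum_prod_type']
  · refine Finset.sum_congr rfl fun p _ => ?_
    rw [if_pos]
    · rfl
    · ext i
      fin_cases i <;> simp [matrixEquivColumns_symm_apply, Matrix.mulVec, dotProduct]
  · intro p _ hp
    refine Finset.sum_eq_zero fun r _ => if_neg fun h => hp ?_
    rw [← h]
    simp [matrixEquivColumns_symm_apply, Matrix.mulVec, dotProduct]
  · simp

/-- The number of `2 × 2` matrices with given trace, determinant and first column. -/
theorem sum_trace_det_first_column (a c τ δ : F) :
    (∑ b : F, ∑ d : F, if a + d = τ ∧ a * d - b * c = δ then (1 : ℂ) else 0) =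
      if c = 0 then (if a * (τ - a) = δ then (Fintype.card F : ℂ) else 0) else 1 := by
  -- The trace determines `d`. The determinant then determines `b` if `c ≠ 0`, and does not involve
  -- `b` if `c = 0`.
  have h (b : F) : (∑ d : F, if a + d = τ ∧ a * d - b * c = δ then (1 : ℂ) else 0) =
      if a * (τ - a) - b * c = δ then 1 else 0 := by
    rw [Finset.sum_eq_single (τ - a)]
    · simp
    · intro d _ hd
      rw [if_neg]
      rintro ⟨h, -⟩
      exact hd (by rw [← h, add_sub_cancel_left])
    · simp
  simp_rw [h]
  split_ifs with hc hδ
  · simp [hc, hδ]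
  · simp [hc, hδ]
  · rw [Finset.sum_eq_single ((a * (τ - a) - δ) / c)]
    · rw [if_pos]
      field_simp
      ring
    · intro b _ hb
      rw [if_neg]
      intro h
      apply hb
      rw [eq_div_iff hc, ← h]
      ring
    · simp

/-- The number of `2 × 2` matrices with characteristic polynomial `(X - t)²`. -/
theorem card_trace_det (t : F) :
    (∑ x : Matrix (Fin 2) (Fin 2) F, if x.trace = 2 * t ∧ x.det = t ^ 2 then (1 : ℂ) else 0) =
      (Fintype.card F : ℂ) ^ 2 := by
  rw [← Equiv.sum_comp (matrixEquivColumns F).symm, Fintype.sum_prod_type, Fintype.sum_prod_type]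
  -- Counting one matrix per first column gives `q²`. The corrections at `c = 0` are `q - 1` for `a
  -- = t` and `-1` for the other `q - 1` values of `a`, so they cancel.
  have h (a c : F) : (∑ p : F × F, if ((matrixEquivColumns F).symm ((a, c), p)).trace = 2 * t ∧
      ((matrixEquivColumns F).symm ((a, c), p)).det = t ^ 2 then (1 : ℂ) else 0) =
      1 + if c = 0 then (if a = t then (Fintype.card F : ℂ) else 0) - 1 else 0 := by
    have h1 := sum_trace_det_first_column a c (2 * t) (t ^ 2)
    rw [← Fintype.sum_prod_type'] at h1
    have h2 : a * (2 * t - a) = t ^ 2 ↔ a = t := by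
      rw [← sub_eq_zero (a := a), ← pow_eq_zero_iff two_ne_zero (a := a - t)]
      constructor <;> intro h <;> linear_combination -h
    rw [if_congr h2 rfl rfl] at h1
    refine Eq.trans ?_ (h1.trans ?_)
    · refine Finset.sum_congr rfl fun p _ => ?_
      simp [matrixEquivColumns_symm_apply, Matrix.trace_fin_two, Matrix.det_fin_two]
    · split_ifs <;> ring
  simp_rw [h, Finset.sum_add_distrib]
  simp
  ring

end RingWalk

/-! ### Replacing the singular part of `Q` by a class function on `GL₂` -/

namespace RingWalk

open Representation PuncturedPlane

variable {F : Type*} [Field F] [DecidableEq F]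

/-- The value of `Q` at the nonzero singular matrices of trace `τ`. -/
noncomputable def traceWeight (Q : Matrix (Fin 2) (Fin 2) F → ℝ) (τ : F) : ℂ :=
  if h : τ = 0 then Q Y₀ else Q (Y (Units.mk0 τ h))

theorem eq_traceWeight {Q : Matrix (Fin 2) (Fin 2) F → ℝ} (hQ : IsSimilarityInvariant Q)
    {x : Matrix (Fin 2) (Fin 2) F} (h0 : x ≠ 0) (hd : x.det = 0) :
    (Q x : ℂ) = traceWeight Q x.trace := by
  rw [traceWeight]
  split_ifs with h
  · rw [hQ _ x (Y₀_mem_simClass h0 hd h)]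
  · rw [hQ _ x (Y_mem_simClass hd (Units.mk0 _ h) rfl)]

theorem traceWeight_units (Q : Matrix (Fin 2) (Fin 2) F → ℝ) (t : Fˣ) :
    traceWeight Q (t : F) = Q (Y t) := by
  rw [traceWeight, dif_neg t.ne_zero]
  congr 3
  exact Units.ext rfl

variable [Fintype F]

/-- The class function on invertible matrices that acts on the nonzero vectors as the singular
part of `Q` does, extended by the same formula to all matrices. -/
noncomputable def singularWeight (Q : Matrix (Fin 2) (Fin 2) F → ℝ)
    (x : Matrix (Fin 2) (Fin 2) F) : ℂ :=
  (Q Y₀ : ℂ) * ((if x.trace = 2 ∧ x.det = 1 then 1 else 0) -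
      if x = 1 then (Fintype.card F : ℂ) else 0) +
    ∑ t : Fˣ, (Q (Y t) : ℂ) * if x.trace = 2 * t ∧ x.det = (t : F) ^ 2 then 1 else 0

theorem singularWeight_of_mem_simClass (Q : Matrix (Fin 2) (Fin 2) F → ℝ)
    {x y : Matrix (Fin 2) (Fin 2) F} (h : y ∈ simClass x) :
    singularWeight Q y = singularWeight Q x := by
  simp only [singularWeight, trace_eq_of_mem_simClass h, det_eq_of_mem_simClass h,
    eq_one_iff_of_mem_simClass h]

/-- This allows sums of the weight over all matrices to be read as sums over invertible ones. -/
theorem singularWeight_of_det_eq_zero (Q : Matrix (Fin 2) (Fin 2) F → ℝ)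
    {x : Matrix (Fin 2) (Fin 2) F} (h : x.det = 0) : singularWeight Q x = 0 := by
  have h1 : x ≠ 1 := by
    rintro rfl
    simp at h
  rw [singularWeight, h, if_neg h1, if_neg fun h => zero_ne_one h.2, sub_zero, mul_zero, zero_add]
  refine Finset.sum_eq_zero fun t _ => ?_
  rw [if_neg fun h => pow_ne_zero 2 t.ne_zero h.2.symm, mul_zero]

theorem sum_traceWeight (Q : Matrix (Fin 2) (Fin 2) F → ℝ) :
    ∑ τ : F, traceWeight Q τ = Q Y₀ + ∑ t : Fˣ, (Q (Y t) : ℂ) := by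
  rw [← Finset.add_sum_erase _ _ (Finset.mem_univ (0 : F)), traceWeight, dif_pos rfl]
  congr 1
  simp_rw [← traceWeight_units]
  refine Eq.trans (Finset.sum_congr ?_ fun _ _ => rfl)
    (Finset.sum_map Finset.univ ⟨Units.val, Units.val_injective⟩ (traceWeight Q))
  ext t
  simp only [Finset.mem_erase, Finset.mem_univ, and_true, Finset.mem_map, true_and]
  exact isUnit_iff_ne_zero.symm

/-- Both weights depend on trace and determinant, apart from the correction at the identity, so
counting matrices with first column `w` suffices. Off the axis `w 1 = 0` every class counts once; on
it, the singular class of trace `t ≠ 0` and the set for `(X - t)²` both count `q` exactly when `w 0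
= t`. The nilpotent class counts zero there, which is why `q` is removed at the identity. -/
theorem sum_mulVec_base_singular {Q : Matrix (Fin 2) (Fin 2) F → ℝ}
    (hQ : IsSimilarityInvariant Q) {w : Fin 2 → F} (hw : w ≠ 0) :
    ∑ x with x *ᵥ ![1, 0] = w, ((if x.det = 0 then (Q x : ℂ) else 0) - singularWeight Q x) = 0 := by
  have hx (b d : F) : (if (!![w 0, b; w 1, d] : Matrix (Fin 2) (Fin 2) F).det = 0 then
      (Q !![w 0, b; w 1, d] : ℂ) else 0) =
      ∑ τ, traceWeight Q τ * if w 0 + d = τ ∧ w 0 * d - b * w 1 = 0 then 1 else 0 := by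
    rw [Matrix.det_fin_two_of]
    split_ifs with h
    · rw [eq_traceWeight hQ _ (by rw [Matrix.det_fin_two_of, h]), Matrix.trace_fin_two_of]
      · simp [h]
      · intro h0
        refine hw (funext fun i => ?_)
        fin_cases i
        · exact congrFun (congrFun h0 0) 0
        · exact congrFun (congrFun h0 1) 0
    · simp [h]
  have hone : (∑ b, ∑ d, if (!![w 0, b; w 1, d] : Matrix (Fin 2) (Fin 2) F) = 1 then
      (Fintype.card F : ℂ) else 0) =
      if w 1 = 0 then (if w 0 = 1 then (Fintype.card F : ℂ) else 0) else 0 := by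
    have (b d : F) : (!![w 0, b; w 1, d] : Matrix (Fin 2) (Fin 2) F) = 1 ↔
        (w 1 = 0 ∧ w 0 = 1) ∧ b = 0 ∧ d = 1 := by
      rw [← Matrix.ext_iff]
      simp [Fin.forall_fin_two]
      tauto
    simp_rw [this, ite_and]
    split_ifs <;> simp
  -- The equation says `(w 0 - t)² = 0`, which covers characteristic two as well.
  have hsq (t : F) : w 0 * (2 * t - w 0) = t ^ 2 ↔ w 0 = t := by
    rw [← sub_eq_zero (a := w 0), ← pow_eq_zero_iff two_ne_zero (a := w 0 - t)]
    constructor <;> intro h <;> linear_combination -h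
  have hsq1 : w 0 * (2 - w 0) = 1 ↔ w 0 = 1 := by
    simpa using hsq 1
  have hQS : ∑ b, ∑ d, (if (!![w 0, b; w 1, d] : Matrix (Fin 2) (Fin 2) F).det = 0 then
      (Q !![w 0, b; w 1, d] : ℂ) else 0) =
      ∑ τ, traceWeight Q τ *
        if w 1 = 0 then (if w 0 * (τ - w 0) = 0 then (Fintype.card F : ℂ) else 0) else 1 := by
    simp_rw [hx]
    rw [Finset.sum_congr rfl fun b _ => Finset.sum_comm, Finset.sum_comm]
    refine Finset.sum_congr rfl fun τ _ => ?_
    simp_rw [← Finset.mul_sum]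
    rw [sum_trace_det_first_column]
  have hζ : ∑ b, ∑ d, singularWeight Q !![w 0, b; w 1, d] =
      (Q Y₀ : ℂ) * ((if w 1 = 0 then (if w 0 = 1 then (Fintype.card F : ℂ) else 0) else 1) -
        if w 1 = 0 then (if w 0 = 1 then (Fintype.card F : ℂ) else 0) else 0) +
      ∑ t : Fˣ, (Q (Y t) : ℂ) *
        if w 1 = 0 then (if w 0 = t then (Fintype.card F : ℂ) else 0) else 1 := by
    simp only [singularWeight, Finset.sum_add_distrib, ← Finset.mul_sum, Finset.sum_sub_distrib,
      hone, Matrix.trace_fin_two_of, Matrix.det_fin_two_of, sum_trace_det_first_column, hsq1]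
    congr 1
    rw [Finset.sum_congr rfl fun b _ => Finset.sum_comm, Finset.sum_comm]
    refine Finset.sum_congr rfl fun t _ => ?_
    simp_rw [← Finset.mul_sum]
    rw [sum_trace_det_first_column, if_congr (hsq t) rfl rfl]
  rw [sum_mulVec_base]
  simp_rw [Finset.sum_sub_distrib]
  rw [hQS, hζ]
  by_cases h1 : w 1 = 0
  · have h0 : w 0 ≠ 0 := fun h0 => hw (funext fun i => by fin_cases i <;> simp [h0, h1])
    simp only [h1, if_true, sub_self, mul_zero, zero_add, mul_eq_zero, h0, false_or, sub_eq_zero]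
    rw [Finset.sum_eq_single (w 0), Finset.sum_eq_single (Units.mk0 _ h0)]
    · simp [← traceWeight_units]
    · intro t _ ht
      rw [if_neg, mul_zero]
      rintro h
      exact ht (Units.ext h.symm)
    · simp
    · intro t _ ht
      rw [if_neg ht, mul_zero]
    · simp
  · simp [h1, sum_traceWeight]

theorem sum_mulVec_singular {Q : Matrix (Fin 2) (Fin 2) F → ℝ}
    (hQ : IsSimilarityInvariant Q) (v w : PuncturedPlane F) :
    ∑ x with x *ᵥ v.1 = w.1,
      ((if x.det = 0 then (Q x : ℂ) else 0) - singularWeight Q x) = 0 := by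
  obtain ⟨g, rfl⟩ := exists_smul_base_eq v
  obtain ⟨w, rfl⟩ := MulAction.surjective g w
  refine Eq.trans ?_ (sum_mulVec_base_singular hQ w.2)
  rw [Finset.sum_filter, Finset.sum_filter]
  -- Conjugation by `g` moves the source vector to the base vector, and both weights are constant on
  -- similarity classes.
  let e : Matrix (Fin 2) (Fin 2) F ≃ Matrix (Fin 2) (Fin 2) F :=
    { toFun := fun x => g * x * (g⁻¹ : GL (Fin 2) F)
      invFun := fun x => (g⁻¹ : GL (Fin 2) F) * x * g
      left_inv := fun x => by simp [mul_assoc]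
      right_inv := fun x => by simp [mul_assoc] }
  rw [← Equiv.sum_comp e]
  refine Finset.sum_congr rfl fun x _ => ?_
  have hx : e x ∈ simClass x := ⟨g, rfl⟩
  rw [det_eq_of_mem_simClass hx, singularWeight_of_mem_simClass Q hx, hQ x _ hx]
  refine if_congr ?_ rfl rfl
  have h1 : e x *ᵥ (g • base F).1 = g.1 *ᵥ (x *ᵥ ![1, 0]) := by
    rw [PuncturedPlane.coe_smul, Matrix.mulVec_mulVec, Matrix.mulVec_mulVec]
    change (g.1 * x * g⁻¹.1 * g.1) *ᵥ ![1, 0] = _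
    rw [mul_assoc, Units.inv_mul, mul_one]
  rw [h1, PuncturedPlane.coe_smul]
  exact (Matrix.mulVec_injective_of_isUnit g.isUnit).eq_iff

/-- The class function on the invertible matrices through which `Q` acts on the nonzero
vectors. -/
noncomputable def rankOneWeight (Q : Matrix (Fin 2) (Fin 2) F → ℝ) (g : GL (Fin 2) F) : ℂ :=
  Q g.1 + singularWeight Q g.1

theorem sum_units_eq_sum_det_ne_zero (f : Matrix (Fin 2) (Fin 2) F → ℂ) :
    ∑ g : GL (Fin 2) F, f g.1 = ∑ x, if x.det = 0 then 0 else f x := by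
  have (x : Matrix (Fin 2) (Fin 2) F) :
      (if x.det = 0 then 0 else f x) = if x.det ≠ 0 then f x else 0 := by
    split_ifs <;> simp_all
  simp_rw [this]
  rw [← Finset.sum_filter]
  refine (Finset.sum_map Finset.univ ⟨Units.val, Units.val_injective⟩ f).symm.trans
    (Finset.sum_congr ?_ fun _ _ => rfl)
  ext x
  simp only [Finset.mem_map, Finset.mem_univ, true_and, Finset.mem_filter]
  constructor
  · rintro ⟨g, rfl⟩
    exact ((Matrix.isUnit_iff_isUnit_det g.1).mp g.isUnit).ne_zero
  · intro h
    exact (Matrix.isUnit_iff_isUnit_det x).mpr (isUnit_iff_ne_zero.mpr h)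

theorem sum_mulVec_eq_sum_rankOneWeight {Q : Matrix (Fin 2) (Fin 2) F → ℝ}
    (hQ : IsSimilarityInvariant Q) (v w : PuncturedPlane F) :
    ∑ x with x *ᵥ v.1 = w.1, (Q x : ℂ) = ∑ g : GL (Fin 2) F with g • v = w, rankOneWeight Q g := by
  have h := sum_mulVec_singular hQ v w
  have h1 : ∑ g : GL (Fin 2) F with g • v = w, rankOneWeight Q g =
      ∑ g : GL (Fin 2) F, if g.1 *ᵥ v.1 = w.1 then (Q g.1 : ℂ) + singularWeight Q g.1 else 0 := by
    rw [Finset.sum_filter]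
    exact Finset.sum_congr rfl fun g _ => if_congr Subtype.ext_iff rfl rfl
  rw [h1, sum_units_eq_sum_det_ne_zero
    fun x => if x *ᵥ v.1 = w.1 then (Q x : ℂ) + singularWeight Q x else 0]
  refine sub_eq_zero.mp (Eq.trans ?_ h)
  rw [Finset.sum_filter, Finset.sum_filter, ← Finset.sum_sub_distrib]
  refine Finset.sum_congr rfl fun x _ => ?_
  by_cases hd : x.det = 0
  · simp [hd, singularWeight_of_det_eq_zero Q hd]
  · simp only [hd, if_false]
    split_ifs <;> ring

end RingWalk

/-! ### From sums over the group to the stated eigenvalue formulas -/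

namespace RingWalk

open Representation PuncturedPlane

theorem sum_units_transversal_mul_ncard {R : Type*} [Ring R] [Fintype R] [Fintype Rˣ]
    [DecidableEq R] {ψ : Finset R} (hψ : IsSimilarityTransversal ψ) (f : Rˣ → ℂ)
    (hf : ∀ g h : Rˣ, f (h * g * h⁻¹) = f g) :
    ∑ x : Rˣ with x.val ∈ ψ, f x * ((simClass x.val).ncard : ℂ) = ∑ g, f g := by
  classical
  -- Extension by zero is constant on similarity classes because conjugation preserves
  -- invertibility.
  let k (x : R) : ℂ := if h : IsUnit x then f h.unit else 0
  have hk (g : Rˣ) : k g.val = f g := by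
    rw [show k g.val = f g.isUnit.unit from dif_pos g.isUnit, IsUnit.unit_of_val_units]
  have hk0 (x : R) (hx : ¬ IsUnit x) : k x = 0 := dif_neg hx
  have hsum := sum_transversal_mul_ncard hψ k fun r s hs => by
    obtain ⟨u, rfl⟩ := hs
    by_cases hr : IsUnit r
    · obtain ⟨g, rfl⟩ := hr
      rw [← Units.val_mul, ← Units.val_mul, hk, hk, hf]
    · rw [hk0 r hr, hk0]
      simpa using hr
  refine Eq.trans ?_ (hsum.trans ?_)
  · refine Finset.sum_of_injOn Units.val Units.val_injective.injOn ?_ ?_ fun g _ => by rw [hk]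
    · intro g hg
      simpa using hg
    · intro x hx hx'
      rw [hk0, zero_mul]
      rintro ⟨g, rfl⟩
      exact hx' ⟨g, by simpa using hx, rfl⟩
  · refine (Finset.sum_of_injOn Units.val Units.val_injective.injOn (by simp) ?_
      fun g _ => (hk g).symm).symm
    intro x _ hx'
    refine hk0 x ?_
    rintro ⟨g, rfl⟩
    exact hx' ⟨g, by simp, rfl⟩

variable {F : Type*} [Field F]

theorem mem_simClass_val_iff {R : Type*} [Ring R] {g h : Rˣ} :
    h.val ∈ simClass g.val ↔ ∃ u, h = u * g * u⁻¹ := by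
  simp only [simClass, Set.mem_ofPred_eq, ← Units.val_mul, Units.val_inj]

theorem mem_simClass_jordan {g : GL (Fin 2) F} {t : Fˣ} (ht : g.1.trace = 2 * t)
    (hd : g.1.det = (t : F) ^ 2) (hg : g ≠ scalarGL t) : g.1 ∈ simClass (jordan t).1 := by
  have hj : (jordan t).1 = !![(t : F), 1; 0, (t : F)] := rfl
  refine mem_simClass_of_trace_eq_of_det_eq (ne_smul_one_of_apply (by simp [hj])) ?_ ?_ ?_
  · intro a ha
    rw [ha, Matrix.det_smul, Matrix.det_one, Fintype.card_fin, mul_one] at hd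
    rw [ha, Matrix.trace_smul, Matrix.trace_one, Fintype.card_fin, smul_eq_mul] at ht
    -- From `a² = t²` and `2a = 2t` one gets `(a - t)² = 0`, with no division by two.
    have hat : a = t := by
      rw [← sub_eq_zero, ← pow_eq_zero_iff two_ne_zero]
      push_cast at ht
      linear_combination (-hd + (t : F) * (-ht) + 2 * hd)
    refine hg (Units.ext ?_)
    rw [ha, hat]
    ext i j
    simp [scalarGL, Matrix.smul_apply, Matrix.one_apply, Matrix.diagonal_apply]
  · rw [ht, hj, Matrix.trace_fin_two_of, two_mul]
  · rw [hd, hj, Matrix.det_fin_two_of, mul_zero, sub_zero, sq]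

theorem zeroEigenvalue_eq_one [Fintype F] {Q : Matrix (Fin 2) (Fin 2) F → ℝ}
    {ψ : Finset (Matrix (Fin 2) (Fin 2) F)} (hQ : IsDistribution Q)
    (hQinv : IsSimilarityInvariant Q) (hψ : IsSimilarityTransversal ψ) : zeroEigenvalue Q ψ = 1 := by
  rw [zeroEigenvalue, sum_transversal_mul_ncard hψ (fun x => (Q x : ℂ))
    fun r s hs => by rw [hQinv r s hs]]
  exact_mod_cast hQ.2

variable [Fintype F] [DecidableEq F]

/-- Of the `q²` matrices with characteristic polynomial `(X - t)²`, one is scalar and the rest are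
conjugate to the Jordan block. -/
theorem sum_trace_det_mul (t : Fˣ) {f : GL (Fin 2) F → ℂ}
    (hf : ∀ g h : GL (Fin 2) F, f (h * g * h⁻¹) = f g) :
    ∑ g : GL (Fin 2) F, (if g.1.trace = 2 * t ∧ g.1.det = (t : F) ^ 2 then (1 : ℂ) else 0) * f g =
      ((Fintype.card F : ℂ) ^ 2 - 1) * f (jordan t) + f (scalarGL t) := by
  have h (g : GL (Fin 2) F) :
      (if g.1.trace = 2 * t ∧ g.1.det = (t : F) ^ 2 then (1 : ℂ) else 0) * f g =
        (if g.1.trace = 2 * t ∧ g.1.det = (t : F) ^ 2 then (1 : ℂ) else 0) * f (jordan t) +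
          if g = scalarGL t then f (scalarGL t) - f (jordan t) else 0 := by
    split_ifs with h1 h2 h2
    · rw [h2]
      ring
    · obtain ⟨u, rfl⟩ := mem_simClass_val_iff.mp (mem_simClass_jordan h1.1 h1.2 h2)
      rw [hf, add_zero]
    · refine (h1 ?_).elim
      rw [h2]
      simp [scalarGL, two_mul, sq]
    · simp
  simp_rw [h]
  rw [Finset.sum_add_distrib, ← Finset.sum_mul, sum_units_eq_sum_det_ne_zero
    fun x => if x.trace = 2 * (t : F) ∧ x.det = (t : F) ^ 2 then (1 : ℂ) else 0]
  have h0 (x : Matrix (Fin 2) (Fin 2) F) :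
      (if x.det = 0 then 0 else if x.trace = 2 * (t : F) ∧ x.det = (t : F) ^ 2 then (1 : ℂ) else 0) =
        if x.trace = 2 * (t : F) ∧ x.det = (t : F) ^ 2 then (1 : ℂ) else 0 := by
    split_ifs with h1 h2 h2
    · exact (pow_ne_zero 2 t.ne_zero (h2.2.symm.trans h1)).elim
    all_goals rfl
  simp_rw [h0]
  rw [card_trace_det, Finset.sum_ite_eq' Finset.univ, if_pos (Finset.mem_univ _)]
  ring

theorem rankOneWeight_conj {Q : Matrix (Fin 2) (Fin 2) F → ℝ} (hQ : IsSimilarityInvariant Q)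
    (g h : GL (Fin 2) F) : rankOneWeight Q (h * g * h⁻¹) = rankOneWeight Q g := by
  have : (h * g * h⁻¹).1 ∈ simClass g.1 := ⟨h, rfl⟩
  rw [rankOneWeight, rankOneWeight, hQ _ _ this, singularWeight_of_mem_simClass Q this]

variable {Q : Matrix (Fin 2) (Fin 2) F → ℝ} {ψ : Finset (Matrix (Fin 2) (Fin 2) F)}
  {V : Type*} [AddCommGroup V] [Module ℂ V]

theorem unitSum_eq_sum (hQinv : IsSimilarityInvariant Q) (hψ : IsSimilarityTransversal ψ)
    (ρ : Representation ℂ (GL (Fin 2) F) V) :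
    unitSum Q ψ ρ = ∑ g, (Q g.1 : ℂ) * ρ.character g := by
  rw [← sum_units_transversal_mul_ncard hψ (fun g => (Q g.1 : ℂ) * ρ.character g), unitSum]
  · exact Finset.sum_congr rfl fun g _ => mul_right_comm _ _ _
  · intro g h
    rw [Representation.char_conj, hQinv g.1 (h * g * h⁻¹).1 ⟨h, rfl⟩]

theorem rankOneEigenvalue_eq_sum (hQinv : IsSimilarityInvariant Q)
    (hψ : IsSimilarityTransversal ψ) (ρ : Representation ℂ (GL (Fin 2) F) V) :
    rankOneEigenvalue Q ψ ρ =
      (∑ g, rankOneWeight Q g * ρ.character g) / (Module.finrank ℂ V : ℂ) := by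
  have hc (g h : GL (Fin 2) F) : ρ.character (h * g * h⁻¹) = ρ.character g :=
    Representation.char_conj ρ g h
  have hscalar : scalarGL (1 : Fˣ) = 1 := map_one _
  -- The identity enters once through the set for `(X - 1)²` and `-q` times through the correction,
  -- which gives the coefficient `-(q - 1)`.
  have h1 : ∑ g : GL (Fin 2) F, ((if g.1.trace = 2 ∧ g.1.det = 1 then (1 : ℂ) else 0) -
        if g.1 = 1 then (Fintype.card F : ℂ) else 0) * ρ.character g =
      ((Fintype.card F : ℂ) ^ 2 - 1) * ρ.character (jordan 1)
        - ((Fintype.card F : ℂ) - 1) * ρ.character 1 := by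
    have := sum_trace_det_mul (1 : Fˣ) hc
    rw [hscalar] at this
    simp only [Units.val_one, mul_one, one_pow] at this
    simp_rw [sub_mul, Finset.sum_sub_distrib]
    rw [this]
    simp only [Units.val_eq_one, ite_mul, zero_mul, Finset.sum_ite_eq', Finset.mem_univ, if_true]
    ring
  rw [rankOneEigenvalue, unitSum_eq_sum hQinv hψ, ← h1]
  congr 1
  simp_rw [← sum_trace_det_mul _ hc, rankOneWeight, singularWeight, add_mul, Finset.sum_mul,
    Finset.sum_add_distrib, Finset.mul_sum, mul_assoc]
  rw [add_assoc, Finset.sum_comm (s := (Finset.univ : Finset Fˣ))]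

end RingWalk

/-! ### Block structure of `B_R` by corank -/

namespace RingWalk

open Representation PuncturedPlane

variable {F : Type*} [Field F]

/-- The nonzero row vectors up to scalars, in reduced echelon form. -/
def echelonRow : Option F → PuncturedPlane F
  | none => ⟨![0, 1], fun h => one_ne_zero (congrFun h 1)⟩
  | some s => ⟨![1, s], fun h => one_ne_zero (congrFun h 0)⟩

/-- A factorisation `v wᵀ` is unique up to moving a scalar between the factors; the echelon form of
the row removes this freedom. -/
theorem vecMulVec_echelonRow_eq_iff {v : Fin 2 → F} {w : PuncturedPlane F} {s s' : Option F} :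
    vecMulVec v (echelonRow s).1 = vecMulVec w.1 (echelonRow s').1 ↔ s = s' ∧ v = w.1 := by
  refine ⟨fun h => ?_, fun ⟨h, h'⟩ => by rw [h, h']⟩
  have hw (h0 : ∀ i, w.1 i = 0) : False := w.2 (funext h0)
  have h0 (i : Fin 2) := congrFun (congrFun h i) 0
  have h1 (i : Fin 2) := congrFun (congrFun h i) 1
  simp only [vecMulVec_apply] at h0 h1
  rcases s with _ | s <;> rcases s' with _ | s' <;>
    simp only [echelonRow, Matrix.cons_val_zero, Matrix.cons_val_one, mul_zero, mul_one] at h0 h1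
  · exact ⟨rfl, funext h1⟩
  · exact (hw fun i => (h0 i).symm).elim
  · exact (hw fun i => by rw [← h1, h0, zero_mul]).elim
  · have hv : v = w.1 := funext h0
    refine ⟨?_, hv⟩
    by_contra hs
    refine hw fun i => ?_
    have := h1 i
    rw [h0, ← sub_eq_zero, ← mul_sub, mul_eq_zero, sub_eq_zero] at this
    exact this.resolve_right fun h => hs (congrArg some h)

theorem exists_eq_vecMulVec_echelonRow {A : Matrix (Fin 2) (Fin 2) F} (h0 : A ≠ 0)
    (hA : A.det = 0) : ∃ (s : Option F) (v : PuncturedPlane F),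
      A = vecMulVec v.1 (echelonRow s).1 := by
  obtain ⟨v, w, rfl⟩ := exists_eq_vecMulVec_of_det_eq_zero h0 hA
  by_cases hw : w.1 0 = 0
  · have h1 : w.1 1 ≠ 0 := fun h1 => w.2 (funext fun i => by fin_cases i <;> assumption)
    refine ⟨none, Units.mk0 _ h1 • v, ?_⟩
    ext i j
    fin_cases j <;> simp [vecMulVec_apply, echelonRow, coe_units_smul, hw, mul_comm]
  · refine ⟨some (w.1 1 / w.1 0), Units.mk0 _ hw • v, ?_⟩
    ext i j
    fin_cases j <;> simp [vecMulVec_apply, echelonRow, coe_units_smul] <;> field_simp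

variable [DecidableEq F]

/-- `0`, `1`, `2` on the invertible matrices, the matrices of rank one, and the zero matrix. -/
def corank (a : Matrix (Fin 2) (Fin 2) F) : ℕ :=
  if a = 0 then 2 else if a.det = 0 then 1 else 0

theorem corank_eq_zero_iff {a : Matrix (Fin 2) (Fin 2) F} : corank a = 0 ↔ a.det ≠ 0 := by
  rw [corank]
  split_ifs with h h' <;> simp_all

theorem corank_eq_one_iff {a : Matrix (Fin 2) (Fin 2) F} :
    corank a = 1 ↔ a ≠ 0 ∧ a.det = 0 := by
  rw [corank]
  split_ifs with h h' <;> simp_all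

theorem corank_eq_two_iff {a : Matrix (Fin 2) (Fin 2) F} : corank a = 2 ↔ a = 0 := by
  rw [corank]
  split_ifs with h h' <;> simp_all

theorem corank_le_corank_mul (x a : Matrix (Fin 2) (Fin 2) F) : corank a ≤ corank (x * a) := by
  by_cases h : a = 0
  · simp [h]
  by_cases h' : a.det = 0
  · rw [corank_eq_one_iff.mpr ⟨h, h'⟩, corank]
    split_ifs with h1 h2
    · exact one_le_two
    · exact le_rfl
    · exact (h2 (by rw [det_mul, h', mul_zero])).elim
  · rw [corank_eq_zero_iff.mpr h']
    exact Nat.zero_le _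

variable [Fintype F] {Q : Matrix (Fin 2) (Fin 2) F → ℝ}

theorem image_corank : Finset.univ.image (corank (F := F)) = {0, 1, 2} := by
  ext k
  simp only [Finset.mem_image, Finset.mem_univ, true_and, Finset.mem_insert,
    Finset.mem_singleton]
  constructor
  · rintro ⟨a, rfl⟩
    rw [corank]
    split_ifs <;> simp
  · rintro (rfl | rfl | rfl)
    · exact ⟨1, corank_eq_zero_iff.mpr (by simp)⟩
    · exact ⟨Y₀, corank_eq_one_iff.mpr ⟨fun h => one_ne_zero (congrFun (congrFun h 1) 0),
        by simp [Y₀]⟩⟩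
    · exact ⟨0, corank_eq_two_iff.mpr rfl⟩

theorem map_mulTransition_apply (Q : Matrix (Fin 2) (Fin 2) F → ℝ)
    (a b : Matrix (Fin 2) (Fin 2) F) :
    (mulTransition Q).map (algebraMap ℝ ℂ) a b =
      ∑ x : Matrix (Fin 2) (Fin 2) F with x * a = b, (Q x : ℂ) := by
  simp [mulTransition]

theorem blockTriangular_mulTransition (Q : Matrix (Fin 2) (Fin 2) F → ℝ) :
    ((mulTransition Q).map (algebraMap ℝ ℂ)).BlockTriangular corank := by
  intro a b hab
  rw [map_mulTransition_apply]
  refine Finset.sum_eq_zero fun x hx => ?_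
  obtain rfl := (Finset.mem_filter.mp hx).2
  exact ((corank_le_corank_mul x a).not_gt hab).elim

/-- The block of `B_R` on the invertible matrices. -/
theorem charpoly_block_zero (hQ : IsSimilarityInvariant Q) :
    (((mulTransition Q).map (algebraMap ℝ ℂ)).toSquareBlock corank 0).charpoly =
      ∏ᶠ c : Irr (GL (Fin 2) F),
        (X - C ((∑ g : GL (Fin 2) F, (Q g.1 : ℂ) * c.rep.character g) / c.dim)) ^ (c.dim ^ 2) := by
  let e : GL (Fin 2) F ≃ {a : Matrix (Fin 2) (Fin 2) F // corank a = 0} :=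
    Equiv.ofBijective (fun g => ⟨g.1, corank_eq_zero_iff.mpr
        ((isUnit_iff_isUnit_det g.1).mp g.isUnit).ne_zero⟩)
      ⟨fun g h hgh => Units.ext (congrArg Subtype.val hgh), fun a => by
        obtain ⟨g, hg⟩ := (isUnit_iff_isUnit_det a.1).mpr
          (isUnit_iff_ne_zero.mpr (corank_eq_zero_iff.mp a.2))
        exact ⟨g, Subtype.ext hg⟩⟩
  rw [← charpoly_sum_regular (fun g : GL (Fin 2) F => (Q g.1 : ℂ))
    fun g h => by rw [hQ g.1 (h * g * h⁻¹).1 ⟨h, rfl⟩], ← charpoly_reindex e.symm]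
  refine charpoly_sum_permRep _ _ fun g h => ?_
  change (mulTransition Q).map (algebraMap ℝ ℂ) g.1 h.1 = _
  rw [map_mulTransition_apply]
  refine (Finset.sum_of_injOn Units.val Units.val_injective.injOn ?_ ?_ fun _ _ => rfl).symm
  · intro x hx
    have hxg : x • g = h := (Finset.mem_filter.mp hx).2
    exact Finset.mem_coe.mpr (Finset.mem_filter.mpr ⟨Finset.mem_univ _, by rw [← hxg]; rfl⟩)
  -- A transition between invertible matrices `g` and `h` can only use `x = h g⁻¹`, which is itself
  -- invertible.
  · intro x hx hx'
    have hx1 : x * g.1 = h.1 := by simpa using hx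
    refine (hx' ⟨h * g⁻¹, by simp, ?_⟩).elim
    rw [Units.val_mul, ← hx1, Units.mul_inv_cancel_right]

/-- The block of `B_R` on the matrices of rank one. -/
theorem charpoly_block_one (hQ : IsSimilarityInvariant Q) :
    (((mulTransition Q).map (algebraMap ℝ ℂ)).toSquareBlock corank 1).charpoly =
      (∑ g, rankOneWeight Q g • planeRep F g).charpoly ^ (Fintype.card F + 1) := by
  let N : Matrix (PuncturedPlane F) (PuncturedPlane F) ℂ :=
    Matrix.of fun v w => ∑ x with x *ᵥ v.1 = w.1, (Q x : ℂ)
  let e : (Σ _ : Option F, PuncturedPlane F) ≃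
      {a : Matrix (Fin 2) (Fin 2) F // corank a = 1} :=
    Equiv.ofBijective (fun p => ⟨vecMulVec p.2.1 (echelonRow p.1).1, corank_eq_one_iff.mpr
        ⟨fun h => by
          obtain ⟨i, hi⟩ := Function.ne_iff.mp p.2.2
          obtain ⟨j, hj⟩ := Function.ne_iff.mp (echelonRow p.1).2
          exact mul_ne_zero hi hj (congrFun (congrFun h i) j), det_vecMulVec _ _⟩⟩)
      ⟨fun ⟨s, v⟩ ⟨s', w⟩ h => by
        obtain ⟨rfl, h'⟩ := vecMulVec_echelonRow_eq_iff.mp (congrArg Subtype.val h)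
        exact Sigma.ext rfl (heq_of_eq (Subtype.ext h')), fun a => by
        have ha := corank_eq_one_iff.mp a.2
        obtain ⟨s, v, h⟩ := exists_eq_vecMulVec_echelonRow ha.1 ha.2
        exact ⟨⟨s, v⟩, Subtype.ext h.symm⟩⟩
  have hN : N.charpoly = (∑ g, rankOneWeight Q g • planeRep F g).charpoly :=
    charpoly_sum_permRep _ _ fun v w => sum_mulVec_eq_sum_rankOneWeight hQ v w
  -- Left multiplication changes only the column factor, so each echelon row carries its own copy of
  -- `N`.
  have hblock : Matrix.reindex e.symm e.symm
      (((mulTransition Q).map (algebraMap ℝ ℂ)).toSquareBlock corank 1) =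
      blockDiagonal' fun _ : Option F => N := by
    ext ⟨s, v⟩ ⟨s', w⟩
    change (mulTransition Q).map (algebraMap ℝ ℂ) (vecMulVec v.1 (echelonRow s).1)
      (vecMulVec w.1 (echelonRow s').1) = _
    rw [map_mulTransition_apply]
    simp_rw [mul_vecMulVec, vecMulVec_echelonRow_eq_iff]
    by_cases h : s = s'
    · subst h
      simp [N]
    · rw [blockDiagonal'_apply_ne _ _ _ h]
      simp [h]
  rw [← charpoly_reindex e.symm, hblock, charpoly_blockDiagonal', Finset.prod_const, hN,
    Finset.card_univ, Fintype.card_option]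

/-- The block of `B_R` on the zero matrix. -/
theorem charpoly_block_two (hQ : IsDistribution Q) :
    (((mulTransition Q).map (algebraMap ℝ ℂ)).toSquareBlock corank 2).charpoly = X - C 1 := by
  let e : Unit ≃ {a : Matrix (Fin 2) (Fin 2) F // corank a = 2} :=
    Equiv.ofBijective (fun _ => ⟨0, corank_eq_two_iff.mpr rfl⟩)
      ⟨fun _ _ _ => rfl, fun a => ⟨(), Subtype.ext (corank_eq_two_iff.mp a.2).symm⟩⟩
  rw [← charpoly_reindex e.symm, Matrix.charpoly, Matrix.det_unique, Matrix.charmatrix_apply_eq]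
  congr 2
  change (mulTransition Q).map (algebraMap ℝ ℂ) 0 0 = _
  rw [map_mulTransition_apply]
  simpa using mod_cast hQ.2

theorem charpoly_mulTransition (hQ : IsDistribution Q) (hQinv : IsSimilarityInvariant Q) :
    ((mulTransition Q).map (algebraMap ℝ ℂ)).charpoly =
      (∏ᶠ c : Irr (GL (Fin 2) F),
        (X - C ((∑ g : GL (Fin 2) F, (Q g.1 : ℂ) * c.rep.character g) / c.dim)) ^ (c.dim ^ 2)) *
      (∑ g, rankOneWeight Q g • planeRep F g).charpoly ^ (Fintype.card F + 1) * (X - C 1) := by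
  rw [(blockTriangular_mulTransition Q).charpoly, image_corank, Finset.prod_insert (by simp),
    Finset.prod_insert (by simp), Finset.prod_singleton, charpoly_block_zero hQinv,
    charpoly_block_one hQinv, charpoly_block_two hQ, mul_assoc]

end RingWalk

/-! ### Counting eigenvalues and assembling the spectrum -/

namespace RingWalk

theorem finprod_ne_pow {ι M : Type*} [CommMonoid M] [Finite ι] (a : ι) (f : ι → M) (n : ℕ) :
    ∏ᶠ (i : ι) (_ : i ≠ a), f i ^ n = (∏ᶠ (i : ι) (_ : i ≠ a), f i) ^ n := by
  classical
  have := Fintype.ofFinite ι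
  rw [finprod_cond_eq_prod_of_cond_iff (t := Finset.univ.erase a) _ (by simp),
    finprod_cond_eq_prod_of_cond_iff (t := Finset.univ.erase a) _ (by simp), Finset.prod_pow]

theorem card_matrix_two (F : Type*) [Fintype F] :
    Fintype.card (Matrix (Fin 2) (Fin 2) F) = Fintype.card F ^ 4 := by
  rw [Fintype.card_congr (matrixEquivColumns F), Fintype.card_prod, Fintype.card_prod]
  ring

variable {F : Type*} [Field F] [Fintype F] [DecidableEq F]

theorem card_GL_two_add (hq : 2 < Fintype.card F) :
    Fintype.card (GL (Fin 2) F) + (Fintype.card F + 1) *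
      (1 + Fintype.card F + (Fintype.card F - 2) * (Fintype.card F + 1)) + 1 =
        Fintype.card F ^ 4 := by
  have h := Matrix.card_GL_field (𝔽 := F) 2
  rw [Nat.card_eq_fintype_card, Fin.prod_univ_two] at h
  rw [h]
  -- Writing `q = k + 3` removes the truncated subtractions and leaves a polynomial identity in `k`.
  obtain ⟨k, hk⟩ := Nat.exists_eq_add_of_lt hq
  rw [hk]
  have h1 : (2 + k + 1) ^ 2 - (2 + k + 1) ^ ((0 : Fin 2) : ℕ) = k ^ 2 + 6 * k + 8 := by
    rw [Fin.val_zero, pow_zero]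
    refine Nat.sub_eq_of_eq_add ?_
    ring
  have h2 : (2 + k + 1) ^ 2 - (2 + k + 1) ^ ((1 : Fin 2) : ℕ) = k ^ 2 + 5 * k + 6 := by
    rw [Fin.val_one, pow_one]
    refine Nat.sub_eq_of_eq_add ?_
    ring
  have h3 : 2 + k + 1 - 2 = k + 1 := by omega
  rw [h1, h2, h3]
  ring

/-- The spectrum of the multiplicative walk on `M₂(F)`, with algebraic multiplicities. -/
theorem charpoly_mulTransition_eq {Q : Matrix (Fin 2) (Fin 2) F → ℝ}
    (hQ : IsDistribution Q) (hQinv : IsSimilarityInvariant Q)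
    {ψ : Finset (Matrix (Fin 2) (Fin 2) F)} (hψ : IsSimilarityTransversal ψ) :
    ((mulTransition Q).map (algebraMap ℝ ℂ)).charpoly =
      (∏ᶠ c : Irr (GL (Fin 2) F), (X - C (unitEigenvalue Q ψ c.rep)) ^ (c.dim ^ 2)) *
      ((X - C (rankOneEigenvalue Q ψ (trivGL F))) ^ ((Fintype.card F + 1) * 1) *
        (X - C (rankOneEigenvalue Q ψ (rhoCompl (1 : MulChar F ℂ)))) ^
          ((Fintype.card F + 1) * Fintype.card F) *
        ∏ᶠ (χ : MulChar F ℂ) (_ : χ ≠ 1), (X - C (rankOneEigenvalue Q ψ (rhoPair χ 1))) ^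
          ((Fintype.card F + 1) * (Fintype.card F + 1))) *
      (X - C (zeroEigenvalue Q ψ)) ^ 1 := by
  have hunit (c : Irr (GL (Fin 2) F)) : unitEigenvalue Q ψ c.rep =
      (∑ g : GL (Fin 2) F, (Q g.1 : ℂ) * c.rep.character g) / c.dim := by
    rw [unitEigenvalue, unitSum_eq_sum hQinv hψ, Module.finrank_fin_fun]
  have hpair (χ : MulChar F ℂ) : rankOneEigenvalue Q ψ (rhoPair χ 1) =
      (∑ g, rankOneWeight Q g * (rhoPair χ 1).character g) / Module.finrank ℂ
        (Representation.IndV (borel F).subtype (borelChar χ (1 : MulChar F ℂ))) :=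
    rankOneEigenvalue_eq_sum hQinv hψ _
  have hplane : (∑ g, rankOneWeight Q g • PuncturedPlane.planeRep F g).charpoly =
      (X - C (rankOneEigenvalue Q ψ (trivGL F))) ^ 1 *
      (X - C (rankOneEigenvalue Q ψ (rhoCompl (1 : MulChar F ℂ)))) ^ Fintype.card F *
      ∏ᶠ (χ : MulChar F ℂ) (_ : χ ≠ 1),
        (X - C (rankOneEigenvalue Q ψ (rhoPair χ 1))) ^ (Fintype.card F + 1) := by
    rw [charpoly_sum_planeRep _ (rankOneWeight_conj hQinv), rankOneEigenvalue_eq_sum hQinv hψ,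
      rankOneEigenvalue_eq_sum hQinv hψ]
    simp_rw [hpair]
  rw [charpoly_mulTransition hQ hQinv, hplane, zeroEigenvalue_eq_one hQ hQinv hψ, pow_one (X - C 1),
    mul_pow, mul_pow, ← finprod_ne_pow]
  simp_rw [hunit, pow_mul]
  rw [pow_right_comm _ 1, pow_right_comm _ (Fintype.card F) (Fintype.card F + 1)]

end RingWalk

theorem mainTheorem4 {F : Type*} [Field F] [Fintype F] [DecidableEq F]
    (q : ℕ) (hcard : Fintype.card F = q) (hq : 2 < q)
    (Q : Matrix (Fin 2) (Fin 2) F → ℝ)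
    (hQ : IsDistribution Q) (hQinv : IsSimilarityInvariant Q)
    (ψ : Finset (Matrix (Fin 2) (Fin 2) F)) (hψ : IsSimilarityTransversal ψ) :
    -- `Irr(GL₂(F))` is finite, and the multiplicities in (a) add up to `|GL₂(F)|`
    Finite (Irr (GL (Fin 2) F)) ∧
    ∑ᶠ c : Irr (GL (Fin 2) F), c.dim ^ 2 = Fintype.card (GL (Fin 2) F) ∧
    -- `1`, `ρ_1` and the `ρ_{χ,1}` with `χ ≠ 1` are irreducible, of dimensions `1`, `q`, `q + 1`,
    -- and the `ρ_{χ,1}` are pairwise inequivalent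
    (trivGL F).IsIrreducible ∧
    (rhoCompl (1 : MulChar F ℂ)).IsIrreducible ∧
    Module.finrank ℂ (detComplement (1 : MulChar F ℂ)).toSubmodule = q ∧
    (∀ χ : MulChar F ℂ, χ ≠ 1 → (rhoPair χ 1).IsIrreducible ∧
      Module.finrank ℂ
        (Representation.IndV (borel F).subtype (borelChar χ (1 : MulChar F ℂ))) = q + 1) ∧
    (∀ χ χ' : MulChar F ℂ, χ ≠ 1 → χ' ≠ 1 →
      Nonempty ((rhoPair χ 1).Equiv (rhoPair χ' 1)) → χ = χ') ∧
    -- they make up `Σ_A` for every `A` of rank one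
    (∀ A : Matrix (Fin 2) (Fin 2) F, A.rank = 1 →
      constituents A = {c : Irr (GL (Fin 2) F) |
        Nonempty (c.rep.Equiv (trivGL F)) ∨
        Nonempty (c.rep.Equiv (rhoCompl (1 : MulChar F ℂ))) ∨
        ∃ χ : MulChar F ℂ, χ ≠ 1 ∧ Nonempty (c.rep.Equiv (rhoPair χ 1))}) ∧
    -- the full spectrum of `B_R`, with algebraic multiplicities
    ((mulTransition Q).map (algebraMap ℝ ℂ)).charpoly =
      (∏ᶠ c : Irr (GL (Fin 2) F), (X - C (unitEigenvalue Q ψ c.rep)) ^ (c.dim ^ 2)) *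
      ((X - C (rankOneEigenvalue Q ψ (trivGL F))) ^ ((q + 1) * 1) *
        (X - C (rankOneEigenvalue Q ψ (rhoCompl (1 : MulChar F ℂ)))) ^ ((q + 1) * q) *
        ∏ᶠ (χ : MulChar F ℂ) (_ : χ ≠ 1),
          (X - C (rankOneEigenvalue Q ψ (rhoPair χ 1))) ^ ((q + 1) * (q + 1))) *
      (X - C (zeroEigenvalue Q ψ)) ^ 1 ∧
    zeroEigenvalue Q ψ = 1 ∧
    -- the total number of eigenvalues
    Fintype.card (GL (Fin 2) F) + (q + 1) * (1 + q + (q - 2) * (q + 1)) + 1 = q ^ 4 ∧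
    Fintype.card (Matrix (Fin 2) (Fin 2) F) = q ^ 4 := by
  subst hcard
  refine ⟨inferInstance, finsum_dim_sq, isIrreducible_trivGL, isIrreducible_rhoCompl,
    finrank_detComplement, fun χ h => ⟨isIrreducible_rhoPair h, finrank_rhoPair χ⟩,
    fun χ χ' h _ ⟨e⟩ => eq_of_rhoPair_equiv h e, fun A hA => constituents_eq hA,
    charpoly_mulTransition_eq hQ hQinv hψ,
    zeroEigenvalue_eq_one hQ hQinv hψ, card_GL_two_add hq, card_matrix_two F⟩
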